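/- **Conventions.** Associators and unitors are suppressed (the monoidal structures need not be strict), and $\varphi.\psi$ denotes $\varphi$ after $\psi$. **Duoidal categories.** A *duoidal category* is a category $\mathcal M$ with two monoidal structures $(\circ,I)$ and $(\bullet,J)$, morphisms $\delta:I\to I\bullet I$, $\varpi:J\circ J\to J$, $\tau:I\to J$ and a morphism $\zeta=\zeta_{A,B,C,D}:(A\bullet B)\circ(C\bullet D)\to(A\circ C)\bullet(B\circ D)$ natural in $A,B,C,D$ (the interchange law), such that $(J,\varpi,\tau)$ is a monoid in $(\mathcal M,\circ,I)$; $(I,\delta,\tau)$ is a comonoid in $(\mathcal M,\bullet,J)$; the two morphisms $(A\bullet B)\circ(C\bullet D)\circ(E\bullet F)\to(A\circ C\circ E)\bullet(B\circ D\circ F)$ built from $\zeta$ coincide, $\zeta.(\zeta\circ(E\bullet F))=\zeta.((A\bullet B)\circ\zeta)$; the two morphisms $(A\bullet B\bullet C)\circ(D\bullet E\bullet F)\to(A\circ D)\bullet(B\circ E)\bullet(C\circ F)$ built from $\zeta$ coincide, $(\zeta\bullet(C\circ F)).\zeta=((A\circ D)\bullet\zeta).\zeta$; and $$\zeta.(\delta\circ(A\bullet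 B))=\mathrm{id}=\zeta.((A\bullet B)\circ\delta),\qquad (\varpi\bullet(A\circ B)).\zeta=\mathrm{id}=((A\circ B)\bullet\varpi).\zeta .$$ **Right weak bimonoids.** A *right weak bimonoid* in $\mathcal M$ is an object $A$ with a monoid structure $(\mu:A\circ A\to A,\ \eta:I\to A)$ in $(\mathcal M,\circ)$ and a comonoid structure $(\Delta:A\to A\bullet A,\ \varepsilon:A\to J)$ in $(\mathcal M,\bullet)$ such that $\Delta.\mu=(\mu\bullet\mu).\zeta.(\Delta\circ\Delta)$ and the following four axioms hold. * (RRU) As morphisms $I\to I\bullet A\bullet A\bullet A$, $$(I\bullet A\bullet\mu\bullet A).(\zeta\bullet A).\big(((I\bullet A)\circ(I\bullet\Delta.\eta))\bullet A\big).\big(((I\bullet A)\circ\delta)\bullet A\big).(I\bullet\Delta.\eta).\delta=(I\bullet A\bullet\Delta).(I\bullet\Delta).(I\bullet\eta).\delta,$$ where $\zeta=\zeta_{I,A,I\bullet A,A}$. * (LRU) As morphisms $I\to A\bullet A\bullet A\bullet I$, $$(A\bullet\mu\bullet A\bullet I).(A\bullet\zeta).\big(A\bullet((A\bullet I)\circ(\Delta.\eta\bullet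 I))\big).\big(A\bullet((A\bullet I)\circ\delta)\big).(\Delta.\eta\bullet I).\delta=(\Delta\bullet A\bullet I).(\Delta\bullet I).(\eta\bullet I).\delta,$$ where $\zeta=\zeta_{A,I,A,A\bullet I}$. * (LRC) As morphisms $J\circ A\circ A\circ A\to J$, $$\varpi.(J\circ\varepsilon.\mu).\big((\varpi\bullet(J\circ A))\circ A\big).\big(((J\circ\varepsilon.\mu)\bullet(J\circ A))\circ A\big).(\zeta\circ A).(J\circ A\circ\Delta\circ A)=\varpi.(J\circ\varepsilon).(J\circ\mu).(J\circ A\circ\mu),$$ where $\zeta=\zeta_{J\circ A,J,A,A}$. * (LLC) As morphisms $J\circ A\circ A\circ A\to J$, $$\varpi.(J\circ\varepsilon.\mu).\big(((J\circ A)\bullet\varpi)\circ A\big).\big(((J\circ A)\bullet(J\circ\varepsilon.\mu))\circ A\big).(\zeta\circ A).(J\circ A\circ\Delta\circ A)=\varpi.(J\circ\varepsilon).(J\circ\mu).(J\circ A\circ\mu),$$ where $\zeta=\zeta_{J,J\circ A,A,A}$. **Weak bimonads.** A functor $F$ between monoidal categories with a monoidal structure $(F_2,F_0)$ and an opmonoidal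 structure $(F^2,F^0)$ is *separable Frobenius* if $F_2.F^2=\mathrm{id}$, $(FX\otimes F_2).(F^2\otimes FZ)=F^2.F_2:F(X\otimes Y)\otimes FZ\to FX\otimes F(Y\otimes Z)$ and $(F_2\otimes FZ).(FX\otimes F^2)=F^2.F_2:FX\otimes F(Y\otimes Z)\to F(X\otimes Y)\otimes FZ$. A *weak bimonad* on a monoidal category $(\mathcal C,\otimes,K)$ is a monad $T$ on $\mathcal C$ together with a monoidal structure on its Eilenberg–Moore category $\mathcal C^T$ and a separable Frobenius (monoidal and opmonoidal) structure on the forgetful functor $U:\mathcal C^T\to\mathcal C$. The functor $T=UF$ is then opmonoidal, via $T_2:T(X\otimes Y)\to TX\otimes TY$ and $T_0:TK\to K$, as the composite of the free functor $F$ (opmonoidal as the left adjoint of the monoidal functor $U$) and the opmonoidal functor $U$. **Theorem.** Let $(\mathcal M,\circ,\bullet)$ be a duoidal category in which idempotent morphisms split, and let $A$ be a right weak bimonoid in $\mathcal M$. Then the monad $(-)\circ A$ on $\mathcal M$, with multiplication and unit induced by $\mu$ and $\eta$, carries the structure of a weak bimonad on $(\mathcal M,\bullet,J)$ whose opmonoidal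 structure on the functor $(-)\circ A$ has binary part $$(X\bullet Y)\circ A\xrightarrow{(X\bullet Y)\circ\Delta}(X\bullet Y)\circ(A\bullet A)\xrightarrow{\ \zeta\ }(X\circ A)\bullet(Y\circ A)$$ for all objects $X,Y$, and nullary part $$J\circ A\xrightarrow{J\circ\varepsilon}J\circ J\xrightarrow{\ \varpi\ }J .$$ -/

import Mathlib

open CategoryTheory

universe v u

/-! ### Two monoidal structures on one category -/

/-- Two monoidal structures `(∘, I)` and `(•, J)` on the same category. They are kept as plain
fields (not instances), since neither of them is to be the default one. -/
class TwoMonoidalStructures (M : Type u) [Category.{v} M] where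
  /-- the monoidal structure `(∘, I)` -/
  circ : MonoidalCategory M
  /-- the monoidal structure `(•, J)` -/
  bull : MonoidalCategory M

namespace Duoidal

section Operations

variable (M : Type u) [Category.{v} M] [TwoMonoidalStructures M]

/-- The monoidal structure `(∘, I)`. -/
abbrev circ : MonoidalCategory M := TwoMonoidalStructures.circ

/-- The monoidal structure `(•, J)`. -/
abbrev bull : MonoidalCategory M := TwoMonoidalStructures.bull

/-- The unit of `∘`. -/
abbrev I : M := (circ M).tensorUnit

/-- The unit of `•`. -/
abbrev J : M := (bull M).tensorUnit

variable {M}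

abbrev circObj (X Y : M) : M := (circ M).tensorObj X Y
abbrev bullObj (X Y : M) : M := (bull M).tensorObj X Y

abbrev circHom {X X' Y Y' : M} (f : X ⟶ X') (g : Y ⟶ Y') : circObj X Y ⟶ circObj X' Y' :=
  (circ M).tensorHom f g
abbrev bullHom {X X' Y Y' : M} (f : X ⟶ X') (g : Y ⟶ Y') : bullObj X Y ⟶ bullObj X' Y' :=
  (bull M).tensorHom f g

abbrev circLeft (X : M) {Y Y' : M} (f : Y ⟶ Y') : circObj X Y ⟶ circObj X Y' :=
  (circ M).whiskerLeft X f
abbrev circRight {X X' : M} (f : X ⟶ X') (Y : M) : circObj X Y ⟶ circObj X' Y :=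
  (circ M).whiskerRight f Y
abbrev bullLeft (X : M) {Y Y' : M} (f : Y ⟶ Y') : bullObj X Y ⟶ bullObj X Y' :=
  (bull M).whiskerLeft X f
abbrev bullRight {X X' : M} (f : X ⟶ X') (Y : M) : bullObj X Y ⟶ bullObj X' Y :=
  (bull M).whiskerRight f Y

end Operations

end Duoidal

infixr:70 " ∘ᵈ " => Duoidal.circObj
infixr:70 " •ᵈ " => Duoidal.bullObj
infixr:70 " ∘ᵐ " => Duoidal.circHom
infixr:70 " •ᵐ " => Duoidal.bullHom
infixr:81 " ◁∘ " => Duoidal.circLeft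
infixl:81 " ▷∘ " => Duoidal.circRight
infixr:81 " ◁• " => Duoidal.bullLeft
infixl:81 " ▷• " => Duoidal.bullRight

namespace Duoidal

section Coherence

variable {M : Type u} [Category.{v} M] [TwoMonoidalStructures M]

/-- The associator of `∘`. -/
abbrev circα (X Y Z : M) : (X ∘ᵈ Y) ∘ᵈ Z ≅ X ∘ᵈ (Y ∘ᵈ Z) := (circ M).associator X Y Z
/-- The left unitor of `∘`. -/
abbrev circl (X : M) : I M ∘ᵈ X ≅ X := (circ M).leftUnitor X
/-- The right unitor of `∘`. -/
abbrev circr (X : M) : X ∘ᵈ I M ≅ X := (circ M).rightUnitor X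
/-- The associator of `•`. -/
abbrev bullα (X Y Z : M) : (X •ᵈ Y) •ᵈ Z ≅ X •ᵈ (Y •ᵈ Z) := (bull M).associator X Y Z
/-- The left unitor of `•`. -/
abbrev bulll (X : M) : J M •ᵈ X ≅ X := (bull M).leftUnitor X
/-- The right unitor of `•`. -/
abbrev bullr (X : M) : X •ᵈ J M ≅ X := (bull M).rightUnitor X

end Coherence

end Duoidal

open Duoidal

/-! ### Duoidal categories -/

/-- A duoidal (or 2-monoidal) category, with not necessarily strict monoidal structures. -/
class DuoidalCategory (M : Type u) [Category.{v} M] extends TwoMonoidalStructures M where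
  /-- `δ : I ⟶ I • I` -/
  δ : I M ⟶ I M •ᵈ I M
  /-- `ϖ : J ∘ J ⟶ J` -/
  ϖ : J M ∘ᵈ J M ⟶ J M
  /-- `τ : I ⟶ J` -/
  τ : I M ⟶ J M
  /-- the interchange law -/
  ζ (A B C D : M) : (A •ᵈ B) ∘ᵈ (C •ᵈ D) ⟶ (A ∘ᵈ C) •ᵈ (B ∘ᵈ D)
  ζ_natural {A A' B B' C C' D D' : M} (a : A ⟶ A') (b : B ⟶ B') (c : C ⟶ C') (d : D ⟶ D') :
    ((a •ᵐ b) ∘ᵐ (c •ᵐ d)) ≫ ζ A' B' C' D' = ζ A B C D ≫ ((a ∘ᵐ c) •ᵐ (b ∘ᵐ d))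
  -- `(J, ϖ, τ)` is a monoid with respect to `∘`
  ϖ_assoc : (ϖ ▷∘ J M) ≫ ϖ = (circα (J M) (J M) (J M)).hom ≫ (J M ◁∘ ϖ) ≫ ϖ
  τ_ϖ : (τ ▷∘ J M) ≫ ϖ = (circl (J M)).hom
  ϖ_τ : (J M ◁∘ τ) ≫ ϖ = (circr (J M)).hom
  -- `(I, δ, τ)` is a comonoid with respect to `•`
  δ_coassoc : δ ≫ (δ ▷• I M) ≫ (bullα (I M) (I M) (I M)).hom = δ ≫ (I M ◁• δ)
  δ_τ_left : δ ≫ (τ ▷• I M) = (bulll (I M)).inv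
  δ_τ_right : δ ≫ (I M ◁• τ) = (bullr (I M)).inv
  -- associativity
  ζ_assoc_circ (A B C D E F : M) :
    (ζ A B C D ▷∘ (E •ᵈ F)) ≫ ζ (A ∘ᵈ C) (B ∘ᵈ D) E F ≫
        ((circα A C E).hom •ᵐ (circα B D F).hom) =
      (circα (A •ᵈ B) (C •ᵈ D) (E •ᵈ F)).hom ≫ ((A •ᵈ B) ◁∘ ζ C D E F) ≫
        ζ A B (C ∘ᵈ E) (D ∘ᵈ F)
  ζ_assoc_bull (A B C D E F : M) :
    ζ (A •ᵈ B) C (D •ᵈ E) F ≫ (ζ A B D E ▷• (C ∘ᵈ F)) ≫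
        (bullα (A ∘ᵈ D) (B ∘ᵈ E) (C ∘ᵈ F)).hom =
      ((bullα A B C).hom ∘ᵐ (bullα D E F).hom) ≫ ζ A (B •ᵈ C) D (E •ᵈ F) ≫
        ((A ∘ᵈ D) ◁• ζ B C E F)
  -- unitality
  δ_unit_left (A B : M) :
    (δ ▷∘ (A •ᵈ B)) ≫ ζ (I M) (I M) A B ≫ ((circl A).hom •ᵐ (circl B).hom) =
      (circl (A •ᵈ B)).hom
  δ_unit_right (A B : M) :
    ((A •ᵈ B) ◁∘ δ) ≫ ζ A B (I M) (I M) ≫ ((circr A).hom •ᵐ (circr B).hom) =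
      (circr (A •ᵈ B)).hom
  ϖ_unit_left (A B : M) :
    ζ (J M) A (J M) B ≫ (ϖ ▷• (A ∘ᵈ B)) ≫ (bulll (A ∘ᵈ B)).hom =
      (bulll A).hom ∘ᵐ (bulll B).hom
  ϖ_unit_right (A B : M) :
    ζ A (J M) B (J M) ≫ ((A ∘ᵈ B) ◁• ϖ) ≫ (bullr (A ∘ᵈ B)).hom =
      (bullr A).hom ∘ᵐ (bullr B).hom

open DuoidalCategory

/-! ### Right weak bimonoids -/

/-- An object `A` with a monoid structure `(μ, η)` with respect to `∘` and a comonoid structure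
`(Δ, ε)` with respect to `•`. -/
class MonoidComonoid {M : Type u} [Category.{v} M] [TwoMonoidalStructures M] (A : M) where
  mon : @MonObj M _ (circ M) A
  comon : @ComonObj M _ (bull M) A

namespace MonoidComonoid

variable {M : Type u} [Category.{v} M] [TwoMonoidalStructures M] (A : M) [MonoidComonoid A]

/-- The multiplication `A ∘ A ⟶ A`. -/
abbrev μ : A ∘ᵈ A ⟶ A := (mon (A := A)).mul
/-- The unit `I ⟶ A`. -/
abbrev η : I M ⟶ A := (mon (A := A)).one
/-- The comultiplication `A ⟶ A • A`. -/
abbrev Δ : A ⟶ A •ᵈ A := (comon (A := A)).comul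
/-- The counit `A ⟶ J`. -/
abbrev ε : A ⟶ J M := (comon (A := A)).counit

end MonoidComonoid

section WeakBimonoid

variable {M : Type u} [Category.{v} M] [DuoidalCategory M] (A : M) [MonoidComonoid A]

open MonoidComonoid

/-- The morphism `ϖ.(J ∘ ε.μ) : (J ∘ A) ∘ A ⟶ J`. -/
abbrev counitMul : (J M ∘ᵈ A) ∘ᵈ A ⟶ J M :=
  (circα (J M) A A).hom ≫ (J M ◁∘ (μ A ≫ ε A)) ≫ ϖ

/-- The morphism `ϖ.(J ∘ ε).(J ∘ μ).(J ∘ A ∘ μ) : J ∘ A ∘ A ∘ A ⟶ J`, which is the common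
lower path of the two counit axioms. -/
abbrev counitMulMul : ((J M ∘ᵈ A) ∘ᵈ A) ∘ᵈ A ⟶ J M :=
  (circα (J M ∘ᵈ A) A A).hom ≫ ((J M ∘ᵈ A) ◁∘ μ A) ≫ (circα (J M) A A).hom ≫
    (J M ◁∘ μ A) ≫ (J M ◁∘ ε A) ≫ ϖ

/-- Right weak bimonoids: the multiplication is comultiplicative, the unit is weakly
comultiplicative (`rru`, `lru`), and the counit is weakly multiplicative (`lrc`, `llc`). -/
class RightWeakBimonoid : Prop where
  mul_comul : μ A ≫ Δ A = (Δ A ∘ᵐ Δ A) ≫ ζ A A A A ≫ (μ A •ᵐ μ A)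
  /-- Here `ζ : (I • A) ∘ ((I • A) • A) ⟶ (I ∘ (I • A)) • (A ∘ A)`. -/
  rru :
    δ ≫ (I M ◁• (η A ≫ Δ A)) ≫ (bullα (I M) A A).inv ≫
        (((circr (I M •ᵈ A)).inv ≫
          ((I M •ᵈ A) ◁∘ δ) ≫
          ((I M •ᵈ A) ◁∘ (I M ◁• (η A ≫ Δ A))) ≫
          ((I M •ᵈ A) ◁∘ (bullα (I M) A A).inv) ≫
          ζ (I M) A (I M •ᵈ A) A ≫
          ((circl (I M •ᵈ A)).hom ▷• (A ∘ᵈ A)) ≫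
          ((I M •ᵈ A) ◁• μ A)) ▷• A) =
      δ ≫ (I M ◁• η A) ≫ (I M ◁• Δ A) ≫ (bullα (I M) A A).inv ≫
        ((I M •ᵈ A) ◁• Δ A) ≫ (bullα (I M •ᵈ A) A A).inv
  /-- Here `ζ : (A • I) ∘ (A • (A • I)) ⟶ (A ∘ A) • (I ∘ (A • I))`. -/
  lru :
    δ ≫ ((η A ≫ Δ A) ▷• I M) ≫ (bullα A A (I M)).hom ≫
        (A ◁• ((circr (A •ᵈ I M)).inv ≫
          ((A •ᵈ I M) ◁∘ δ) ≫
          ((A •ᵈ I M) ◁∘ ((η A ≫ Δ A) ▷• I M)) ≫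
          ((A •ᵈ I M) ◁∘ (bullα A A (I M)).hom) ≫
          ζ A (I M) A (A •ᵈ I M) ≫
          ((A ∘ᵈ A) ◁• (circl (A •ᵈ I M)).hom) ≫
          (μ A ▷• (A •ᵈ I M)))) =
      δ ≫ (η A ▷• I M) ≫ (Δ A ▷• I M) ≫ (bullα A A (I M)).hom ≫
        (Δ A ▷• (A •ᵈ I M)) ≫ (bullα A A (A •ᵈ I M)).hom
  /-- Here `ζ : ((J ∘ A) • J) ∘ (A • A) ⟶ ((J ∘ A) ∘ A) • (J ∘ A)`. -/
  lrc :
    ((((J M ∘ᵈ A) ◁∘ Δ A) ≫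
        ((bullr (J M ∘ᵈ A)).inv ▷∘ (A •ᵈ A)) ≫
        ζ (J M ∘ᵈ A) (J M) A A ≫
        (counitMul A ▷• (J M ∘ᵈ A)) ≫
        (bulll (J M ∘ᵈ A)).hom) ▷∘ A) ≫ counitMul A =
      counitMulMul A
  /-- Here `ζ : (J • (J ∘ A)) ∘ (A • A) ⟶ (J ∘ A) • ((J ∘ A) ∘ A)`. -/
  llc :
    ((((J M ∘ᵈ A) ◁∘ Δ A) ≫
        ((bulll (J M ∘ᵈ A)).inv ▷∘ (A •ᵈ A)) ≫
        ζ (J M) (J M ∘ᵈ A) A A ≫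
        ((J M ∘ᵈ A) ◁• counitMul A) ≫
        (bullr (J M ∘ᵈ A)).hom) ▷∘ A) ≫ counitMul A =
      counitMulMul A

end WeakBimonoid

/-! ### Weak bimonads -/

section WeakBimonad

open MonoidalCategory Functor.LaxMonoidal Functor.OplaxMonoidal

/-- A separable Frobenius monoidal functor: a functor with a monoidal and an opmonoidal structure
which obey the two Frobenius conditions, such that the binary part of the monoidal structure is
a left inverse of the binary part of the opmonoidal structure. -/
structure IsSeparableFrobenius {C : Type*} [Category C] [MonoidalCategory C]
    {D : Type*} [Category D] [MonoidalCategory D] (F : C ⥤ D)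
    [F.LaxMonoidal] [F.OplaxMonoidal] : Prop where
  frobenius_left (X Y Z : C) :
    (δ F X Y ▷ F.obj Z) ≫ (α_ (F.obj X) (F.obj Y) (F.obj Z)).hom ≫ (F.obj X ◁ μ F Y Z) =
      μ F (X ⊗ Y) Z ≫ F.map (α_ X Y Z).hom ≫ δ F X (Y ⊗ Z)
  frobenius_right (X Y Z : C) :
    (F.obj X ◁ δ F Y Z) ≫ (α_ (F.obj X) (F.obj Y) (F.obj Z)).inv ≫ (μ F X Y ▷ F.obj Z) =
      μ F X (Y ⊗ Z) ≫ F.map (α_ X Y Z).inv ≫ δ F (X ⊗ Y) Z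
  separable (X Y : C) : δ F X Y ≫ μ F X Y = 𝟙 (F.obj (X ⊗ Y))

/-- The structure of a weak bimonad on a monad `T` on a monoidal category: a monoidal structure on
the Eilenberg-Moore category of `T` and a separable Frobenius monoidal structure on the
forgetful functor. -/
structure WeakBimonad {C : Type u} [Category.{v} C] [MonoidalCategory C] (T : Monad C) where
  algebraMonoidal : MonoidalCategory T.Algebra
  forgetLax : T.forget.LaxMonoidal
  forgetOplax : T.forget.OplaxMonoidal
  separableFrobenius : IsSeparableFrobenius T.forget

/-- The opmonoidal structure which a weak bimonad carries on its underlying endofunctor `T`: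
`T` is the composite of the free functor, which is opmonoidal as the left adjoint of the monoidal
forgetful functor, with the opmonoidal forgetful functor. -/
@[reducible] def WeakBimonad.opmonoidal {C : Type u} [Category.{v} C] [MonoidalCategory C]
    {T : Monad C} (W : WeakBimonad T) : T.toFunctor.OplaxMonoidal :=
  letI := W.algebraMonoidal
  letI := W.forgetLax
  letI := W.forgetOplax
  letI := T.adj.leftAdjointOplaxMonoidal
  inferInstanceAs (T.free ⋙ T.forget).OplaxMonoidal

/-- The binary part `T (X ⊗ Y) ⟶ T X ⊗ T Y` of the opmonoidal structure. -/
def WeakBimonad.binary {C : Type u} [Category.{v} C] [MonoidalCategory C]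
    {T : Monad C} (W : WeakBimonad T) (X Y : C) : T.obj (X ⊗ Y) ⟶ T.obj X ⊗ T.obj Y :=
  W.opmonoidal.δ X Y

/-- The nullary part `T K ⟶ K` of the opmonoidal structure, `K` being the monoidal unit. -/
def WeakBimonad.nullary {C : Type u} [Category.{v} C] [MonoidalCategory C]
    {T : Monad C} (W : WeakBimonad T) : T.obj (𝟙_ C) ⟶ 𝟙_ C :=
  W.opmonoidal.η

/-- The monad `(-) ⊗ A` on a monoidal category, for a monoid `A`. -/
def tensorRightMonad {C : Type u} [Category.{v} C] [MonoidalCategory C] (A : C) [MonObj A] :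
    Monad C where
  toFunctor := tensorRight A
  η :=
    { app := fun X => (ρ_ X).inv ≫ (X ◁ MonObj.one)
      naturality := fun X Y f => by simp [whisker_exchange] }
  μ :=
    { app := fun X => (α_ X A A).hom ≫ (X ◁ MonObj.mul)
      naturality := fun X Y f => by
        dsimp
        rw [Category.assoc, whisker_exchange, associator_naturality_left_assoc] }
  assoc X := by
    have h : (X ◁ (MonObj.mul (X := A) ▷ A)) ≫ (X ◁ MonObj.mul) =
        (X ◁ (α_ A A A).hom) ≫ (X ◁ (A ◁ MonObj.mul)) ≫ (X ◁ MonObj.mul) := by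
      simp only [← MonoidalCategory.whiskerLeft_comp, MonObj.mul_assoc]
    simp [h]
  left_unit X := by
    have h : (X ◁ (A ◁ MonObj.one)) ≫ (X ◁ MonObj.mul (X := A)) = X ◁ (ρ_ A).hom := by
      simp only [← MonoidalCategory.whiskerLeft_comp, MonObj.mul_one]
    simp [h]
  right_unit X := by
    have h : (X ◁ (MonObj.one ▷ A)) ≫ (X ◁ MonObj.mul (X := A)) = X ◁ (λ_ A).hom := by
      simp only [← MonoidalCategory.whiskerLeft_comp, MonObj.one_mul]
    simp [h]

end WeakBimonad

/-- The monad `(-) ∘ A`. -/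
abbrev circMonad {M : Type u} [Category.{v} M] [TwoMonoidalStructures M] (A : M)
    [MonoidComonoid A] : Monad M :=
  @tensorRightMonad M _ (circ M) A MonoidComonoid.mon

/-!
The argument has two halves: the weak bimonoid `A` is used only through three properties of the
monad `T = (-) ∘ A` on the monoidal category `(M, •, J)`, and any monad with these properties is a
weak bimonad as soon as idempotents split.

Consider a monad `T` on a monoidal category with unit `K`, whose underlying functor is opmonoidal,
via `T_2 = δ₂` and `T_0 = δ₀`. The properties are

* `MulOpmonoidal`: `T_2` is compatible with the multiplication of `T`;
* `WeaklyUnital`: the unit of `T` need not be opmonoidal, but `T_2.η : X ⊗ Y ⟶ T X ⊗ T Y` is weakly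
  comultiplicative; for a weak bialgebra this says
  `1₁ ⊗ 1₂ ⊗ 1₃ = 1₁ ⊗ 1'₁ 1₂ ⊗ 1'₂ = 1₁ ⊗ 1₂ 1'₁ ⊗ 1'₂`;
* `WeaklyCounital`: `ε(a b₁) ε(b₂ c) = ε(a b c) = ε(a b₂) ε(b₁ c)`.

Comments use Sweedler notation: an element of `T X` is written `x h`, with `a`, `b` in `T K`, the
morphism `T_2` is `(x ⊗ y) h ↦ x h₁ ⊗ y h₂`, the morphism `T_0` is `ε`, the multiplication of `T` is
written as a product, and `1₁ ⊗ 1₂` stands for `T_2.η`. This is a guide only; the morphisms and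
their equalities make sense for every `T`.

*The weak bimonad.* For algebras `P` and `Q`, the diagonal action `(p ⊗ q) h = p h₁ ⊗ q h₂` on
`P ⊗ Q` is associative by `MulOpmonoidal` but not unital. Its unit acts by an idempotent `idem P Q`,
whose splitting is an algebra `P □ Q` (`NonunitalAlgebra.split`, `box`), with inclusion `incl` and
projection `proj`. The idempotents which define `(P □ Q) □ S` and `P □ (Q □ S)` both become
`p 1₁ ⊗ q 1₂ ⊗ s 1₃`, by the coassociativity of `T_2`, so the associator of the underlying
objects restricts to one of algebras. The unit object `R` is the splitting of the idempotent
`a ↦ 1₁ ε(a 1₂)` of `T K`; that it is an algebra follows from `WeaklyCounital`, since that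
idempotent identifies elements with the same functional `ε(a -)` (`comp_unitIdem_ext`). The
unitors are `a ⊗ p ↦ ε(a) p` and its mirror image. They are morphisms of algebras by
`ε(a 1₁) x 1₂ h = ε(a h₁) x h₂` (`map_unitCutLeft_mul`) and invertible by `unitCutLeft_unit₂`. The
morphisms `proj` and `K ⟶ R`, respectively `incl` and `R ⟶ K`, make the forgetful functor monoidal
and opmonoidal. Separability is `incl_proj`. The Frobenius conditions hold because `WeaklyUnital`
factorizes the idempotent of the threefold product into those of the twofold products
(`idemRight_eq`, `idemLeft_eq`). The opmonoidal structure induced on `T` is the given one, since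
the transposes of `X ⊗ Y ⟶ T X □ T Y` and of `K ⟶ R` are `T_2` followed by a projection and the
projection `T K ⟶ R` (`weakBimonad_binary`, `weakBimonad_nullary`).

*The monad `(-) ∘ A`.* The functor `(-) ∘ A` is opmonoidal by `ζ.((X • Y) ∘ Δ)` and `ϖ.(J ∘ ε)`.
`MulOpmonoidal` is the multiplicativity of `Δ` together with the associativity of `ζ`, and
`WeaklyCounital` is `lrc` and `llc`. The morphism `T_2.η` is the insertion `act` of
`Δ.η : I ⟶ A • A`. `WeaklyUnital` follows from `rru` and `lru`: the superfluous factor `I` is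
removed from them by `τ` (`unitComul_right`, `unitComul_left`), and the resulting equalities are
inserted in three factors `X • Y • Z`, where the interchange law turns them into the desired ones
(`bullLeft_act`, `bullRight_act`, `circLeft_act_ζ`).
-/

/-! ### Splitting nonunital algebras of a monad -/

namespace CategoryTheory.Monad

open CategoryTheory Category

section Naturality

variable {C : Type u} [Category.{v} C] (T : Monad C)

/-- The multiplication of the monad, with the type `T (T X) ⟶ T X`. -/
abbrev mul (X : C) : T.obj (T.obj X) ⟶ T.obj X := T.μ.app X

lemma η_nat {X Y : C} (f : X ⟶ Y) : f ≫ T.η.app Y = T.η.app X ≫ T.map f := T.η.naturality f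

lemma μ_nat {X Y : C} (f : X ⟶ Y) : T.map (T.map f) ≫ T.mul Y = T.mul X ≫ T.map f :=
  T.μ.naturality f

lemma map_μ (X : C) : T.map (T.mul X) ≫ T.mul X = T.mul (T.obj X) ≫ T.mul X :=
  T.assoc X

lemma map_η_μ (X : C) : T.map (T.η.app X) ≫ T.mul X = 𝟙 (T.obj X) := T.right_unit X

lemma η_μ (X : C) : T.η.app (T.obj X) ≫ T.mul X = 𝟙 (T.obj X) := T.left_unit X

end Naturality

/-- A nonunital algebra of a monad `T`: an object with an associative action of `T` which need not
be unital. -/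
structure NonunitalAlgebra {C : Type u} [Category.{v} C] (T : Monad C) where
  /-- the underlying object -/
  A : C
  /-- the action -/
  a : T.obj A ⟶ A
  assoc : T.mul A ≫ a = T.map a ≫ a

namespace NonunitalAlgebra

variable {C : Type u} [Category.{v} C] {T : Monad C} (N : NonunitalAlgebra T)

/-- The idempotent by which the unit of the monad acts. -/
def idem : N.A ⟶ N.A := T.η.app N.A ≫ N.a

lemma a_idem : N.a ≫ N.idem = N.a := by
  rw [idem, reassoc_of% η_nat, ← N.assoc, reassoc_of% T.η_μ]

lemma map_idem_a : T.map N.idem ≫ N.a = N.a := by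
  rw [idem, Functor.map_comp, Category.assoc, ← N.assoc, reassoc_of% T.map_η_μ]

lemma idem_idem : N.idem ≫ N.idem = N.idem := by
  nth_rw 1 [idem]
  rw [Category.assoc, a_idem, idem]

variable [IsIdempotentComplete C]

lemma exists_split : ∃ (P : T.Algebra) (i : P.A ⟶ N.A) (e : N.A ⟶ P.A),
    i ≫ e = 𝟙 P.A ∧ e ≫ i = N.idem ∧ P.a ≫ i = T.map i ≫ N.a := by
  obtain ⟨Y, i, e, hi, he⟩ := IsIdempotentComplete.idempotents_split _ _ N.idem_idem
  have hie : N.idem ≫ e = e := by rw [← he, Category.assoc, hi, comp_id]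
  refine ⟨⟨Y, T.map i ≫ N.a ≫ e, ?_, ?_⟩, i, e, hi, he, ?_⟩
  · rw [← reassoc_of% T.η_nat i, ← Category.assoc (T.η.app _), ← idem, hie, hi]
  · rw [← reassoc_of% μ_nat, reassoc_of% N.assoc]
    simp only [Functor.map_comp, Category.assoc]
    rw [← Functor.map_comp_assoc T.toFunctor e, he, reassoc_of% N.map_idem_a]
  · simp only [Category.assoc, he, a_idem]

/-- The algebra obtained by splitting the idempotent of a nonunital algebra. -/
noncomputable def split : T.Algebra := N.exists_split.choose

/-- The inclusion of the splitting. -/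
noncomputable def ι : N.split.A ⟶ N.A := N.exists_split.choose_spec.choose

/-- The projection to the splitting. -/
noncomputable def π : N.A ⟶ N.split.A := N.exists_split.choose_spec.choose_spec.choose

lemma ι_π : N.ι ≫ N.π = 𝟙 _ := N.exists_split.choose_spec.choose_spec.choose_spec.1

lemma π_ι : N.π ≫ N.ι = N.idem := N.exists_split.choose_spec.choose_spec.choose_spec.2.1

lemma split_a_ι : N.split.a ≫ N.ι = T.map N.ι ≫ N.a :=
  N.exists_split.choose_spec.choose_spec.choose_spec.2.2

instance : Mono N.ι := mono_of_mono_fac N.ι_π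

lemma map_π_split_a : T.map N.π ≫ N.split.a = N.a ≫ N.π := by
  rw [← cancel_mono N.ι, Category.assoc, Category.assoc, split_a_ι, ← Functor.map_comp_assoc, π_ι,
    map_idem_a, a_idem]

end NonunitalAlgebra

end CategoryTheory.Monad

/-! ### The tensor product of algebras of a monad which is opmonoidal as a functor -/

namespace CategoryTheory.Monad

open CategoryTheory Category MonoidalCategory

variable {C : Type u} [Category.{v} C] [MonoidalCategory C] (T : Monad C)
  [T.toFunctor.OplaxMonoidal]

/-- The binary part `T (X ⊗ Y) ⟶ T X ⊗ T Y` of the opmonoidal structure of the functor `T`. -/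
abbrev δ₂ (X Y : C) : T.obj (X ⊗ Y) ⟶ T.obj X ⊗ T.obj Y :=
  Functor.OplaxMonoidal.δ T.toFunctor X Y

/-- The nullary part `T K ⟶ K` of the opmonoidal structure of the functor `T`. -/
abbrev δ₀ : T.obj (𝟙_ C) ⟶ 𝟙_ C := Functor.OplaxMonoidal.η T.toFunctor

lemma δ₂_nat {X Y X' Y' : C} (f : X ⟶ Y) (g : X' ⟶ Y') :
    T.map (f ⊗ₘ g) ≫ T.δ₂ Y Y' = T.δ₂ X X' ≫ (T.map f ⊗ₘ T.map g) :=
  (Functor.OplaxMonoidal.δ_natural T.toFunctor f g).symm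

lemma δ₂_nat_left {X Y : C} (f : X ⟶ Y) (Z : C) :
    T.map (f ▷ Z) ≫ T.δ₂ Y Z = T.δ₂ X Z ≫ T.map f ▷ T.obj Z :=
  (Functor.OplaxMonoidal.δ_natural_left T.toFunctor f Z).symm

lemma δ₂_nat_right {X Y : C} (Z : C) (f : X ⟶ Y) :
    T.map (Z ◁ f) ≫ T.δ₂ Z Y = T.δ₂ Z X ≫ T.obj Z ◁ T.map f :=
  (Functor.OplaxMonoidal.δ_natural_right T.toFunctor Z f).symm

lemma δ₂_assoc (X Y Z : C) :
    T.δ₂ (X ⊗ Y) Z ≫ T.δ₂ X Y ▷ T.obj Z ≫ (α_ (T.obj X) (T.obj Y) (T.obj Z)).hom =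
      T.map (α_ X Y Z).hom ≫ T.δ₂ X (Y ⊗ Z) ≫ T.obj X ◁ T.δ₂ Y Z :=
  Functor.OplaxMonoidal.oplax_associativity T.toFunctor X Y Z

lemma δ₂_counit_left (X : C) :
    T.map (λ_ X).inv ≫ T.δ₂ (𝟙_ C) X ≫ T.δ₀ ▷ T.obj X = (λ_ (T.obj X)).inv :=
  (Functor.OplaxMonoidal.oplax_left_unitality T.toFunctor X).symm

lemma δ₂_counit_right (X : C) :
    T.map (ρ_ X).inv ≫ T.δ₂ X (𝟙_ C) ≫ T.obj X ◁ T.δ₀ = (ρ_ (T.obj X)).inv :=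
  (Functor.OplaxMonoidal.oplax_right_unitality T.toFunctor X).symm

/-- The map `T_2.η : X ⊗ Y ⟶ T X ⊗ T Y`, which measures how far the unit of the monad is from
being opmonoidal. -/
def unit₂ (X Y : C) : X ⊗ Y ⟶ T.obj X ⊗ T.obj Y := T.η.app (X ⊗ Y) ≫ T.δ₂ X Y

lemma unit₂_nat {X Y X' Y' : C} (f : X ⟶ Y) (g : X' ⟶ Y') :
    (f ⊗ₘ g) ≫ T.unit₂ Y Y' = T.unit₂ X X' ≫ (T.map f ⊗ₘ T.map g) := by
  rw [unit₂, reassoc_of% η_nat, δ₂_nat, unit₂, Category.assoc]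

lemma unit₂_nat_left {X Y : C} (f : X ⟶ Y) (Z : C) :
    f ▷ Z ≫ T.unit₂ Y Z = T.unit₂ X Z ≫ T.map f ▷ T.obj Z := by
  rw [unit₂, reassoc_of% η_nat, δ₂_nat_left, unit₂, Category.assoc]

lemma unit₂_nat_right {X Y : C} (Z : C) (f : X ⟶ Y) :
    Z ◁ f ≫ T.unit₂ Z Y = T.unit₂ Z X ≫ T.obj Z ◁ T.map f := by
  rw [unit₂, reassoc_of% η_nat, δ₂_nat_right, unit₂, Category.assoc]

lemma unit₂_assoc (X Y Z : C) :
    T.unit₂ (X ⊗ Y) Z ≫ T.δ₂ X Y ▷ T.obj Z ≫ (α_ (T.obj X) (T.obj Y) (T.obj Z)).hom =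
      (α_ X Y Z).hom ≫ T.unit₂ X (Y ⊗ Z) ≫ T.obj X ◁ T.δ₂ Y Z := by
  rw [unit₂, Category.assoc, δ₂_assoc, ← reassoc_of% η_nat, unit₂, Category.assoc]

lemma unit₂_assoc_inv (X Y Z : C) :
    T.unit₂ X (Y ⊗ Z) ≫ T.obj X ◁ T.δ₂ Y Z =
      (α_ X Y Z).inv ≫ T.unit₂ (X ⊗ Y) Z ≫ T.δ₂ X Y ▷ T.obj Z ≫ (α_ _ _ _).hom := by
  rw [unit₂_assoc, Iso.inv_hom_id_assoc]

/-- The binary part of the opmonoidal structure of `T` is compatible with the multiplication. -/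
class MulOpmonoidal : Prop where
  μ_δ₂ : ∀ X Y : C, T.mul (X ⊗ Y) ≫ T.δ₂ X Y =
    T.map (T.δ₂ X Y) ≫ T.δ₂ (T.obj X) (T.obj Y) ≫ (T.mul X ⊗ₘ T.mul Y)

variable {T}

namespace Algebra

/-- The idempotent on `P ⊗ Q` whose image is `P □ Q`. -/
def idem (P Q : T.Algebra) : P.A ⊗ Q.A ⟶ P.A ⊗ Q.A := T.unit₂ P.A Q.A ≫ (P.a ⊗ₘ Q.a)

lemma idem_naturality {P Q P' Q' : T.Algebra} (f : P ⟶ P') (g : Q ⟶ Q') :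
    idem P Q ≫ (f.f ⊗ₘ g.f) = (f.f ⊗ₘ g.f) ≫ idem P' Q' := by
  simp only [idem, reassoc_of% unit₂_nat, tensorHom_comp_tensorHom, Category.assoc, Hom.h]

/-- The idempotent on `(P ⊗ Q) ⊗ S` through which the inclusion of `(P □ Q) □ S` factorizes. -/
def idemLeft (P Q S : T.Algebra) : (P.A ⊗ Q.A) ⊗ S.A ⟶ (P.A ⊗ Q.A) ⊗ S.A :=
  T.unit₂ (P.A ⊗ Q.A) S.A ≫ (T.δ₂ P.A Q.A ▷ T.obj S.A) ≫ ((P.a ⊗ₘ Q.a) ⊗ₘ S.a)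

/-- The idempotent on `P ⊗ (Q ⊗ S)` through which the inclusion of `P □ (Q □ S)` factorizes. -/
def idemRight (P Q S : T.Algebra) : P.A ⊗ Q.A ⊗ S.A ⟶ P.A ⊗ Q.A ⊗ S.A :=
  T.unit₂ P.A (Q.A ⊗ S.A) ≫ (T.obj P.A ◁ T.δ₂ Q.A S.A) ≫ (P.a ⊗ₘ (Q.a ⊗ₘ S.a))

lemma idemLeft_associator (P Q S : T.Algebra) :
    idemLeft P Q S ≫ (α_ _ _ _).hom = (α_ _ _ _).hom ≫ idemRight P Q S := by
  rw [idemLeft, idemRight, Category.assoc, Category.assoc, associator_naturality,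
    reassoc_of% unit₂_assoc]

end Algebra

variable [T.MulOpmonoidal]

/-- The tensor product of two algebras of `T`, with the diagonal action. -/
def Algebra.tensor (P Q : T.Algebra) : NonunitalAlgebra T where
  A := P.A ⊗ Q.A
  a := T.δ₂ P.A Q.A ≫ (P.a ⊗ₘ Q.a)
  assoc := by
    rw [← Category.assoc, MulOpmonoidal.μ_δ₂]
    simp only [Functor.map_comp, Category.assoc, tensorHom_comp_tensorHom, reassoc_of% δ₂_nat,
      Algebra.assoc]

namespace Algebra

lemma tensor_idem (P Q : T.Algebra) :
    (tensor P Q).idem = idem P Q := by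
  simp [NonunitalAlgebra.idem, tensor, unit₂, idem]

lemma map_idem_a (P Q : T.Algebra) :
    T.map (idem P Q) ≫ T.δ₂ P.A Q.A ≫ (P.a ⊗ₘ Q.a) = T.δ₂ P.A Q.A ≫ (P.a ⊗ₘ Q.a) := by
  have := (tensor P Q).map_idem_a
  rwa [tensor_idem] at this

variable [IsIdempotentComplete C]

/-- The monoidal product `P □ Q` of algebras, a retract of `P ⊗ Q`. -/
noncomputable def box (P Q : T.Algebra) : T.Algebra := (tensor P Q).split

/-- The inclusion `P □ Q ⟶ P ⊗ Q`. -/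
noncomputable def incl (P Q : T.Algebra) : (box P Q).A ⟶ P.A ⊗ Q.A := (tensor P Q).ι

/-- The projection `P ⊗ Q ⟶ P □ Q`. -/
noncomputable def proj (P Q : T.Algebra) : P.A ⊗ Q.A ⟶ (box P Q).A := (tensor P Q).π

lemma incl_proj (P Q : T.Algebra) : incl P Q ≫ proj P Q = 𝟙 _ := (tensor P Q).ι_π

instance (P Q : T.Algebra) : IsSplitMono (incl P Q) :=
  IsSplitMono.mk' ⟨proj P Q, incl_proj P Q⟩

instance (X : C) {Y Z : C} (f : Y ⟶ Z) [IsSplitMono f] : IsSplitMono (X ◁ f) :=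
  inferInstanceAs (IsSplitMono ((tensorLeft X).map f))

instance (X : C) {Y Z : C} (f : Y ⟶ Z) [IsSplitMono f] : IsSplitMono (f ▷ X) :=
  inferInstanceAs (IsSplitMono ((tensorRight X).map f))

lemma proj_incl (P Q : T.Algebra) : proj P Q ≫ incl P Q = idem P Q :=
  (tensor P Q).π_ι.trans (tensor_idem P Q)

lemma incl_idem (P Q : T.Algebra) : incl P Q ≫ idem P Q = incl P Q := by
  rw [← proj_incl, reassoc_of% incl_proj]

lemma box_a_incl (P Q : T.Algebra) :
    (box P Q).a ≫ incl P Q = T.map (incl P Q) ≫ T.δ₂ P.A Q.A ≫ (P.a ⊗ₘ Q.a) :=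
  (tensor P Q).split_a_ι

/-- A morphism into `P □ Q` is a morphism of algebras as soon as its composite with the
inclusion in `P ⊗ Q` is compatible with the actions. -/
noncomputable def homOfIncl {N P Q : T.Algebra} (f : N.A ⟶ (box P Q).A)
    (h : T.map (f ≫ incl P Q) ≫ T.δ₂ P.A Q.A ≫ (P.a ⊗ₘ Q.a) = N.a ≫ f ≫ incl P Q) :
    N ⟶ box P Q where
  f := f
  h := by
    rw [← cancel_mono (incl P Q), Category.assoc, Category.assoc, box_a_incl, ← h,
      Functor.map_comp_assoc]

/-- The monoidal product of morphisms of algebras. -/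
noncomputable def boxHom {P Q P' Q' : T.Algebra} (f : P ⟶ P') (g : Q ⟶ Q') :
    box P Q ⟶ box P' Q' :=
  homOfIncl (incl P Q ≫ (f.f ⊗ₘ g.f) ≫ proj P' Q') (by
    simp only [Category.assoc, proj_incl, ← idem_naturality, reassoc_of% incl_idem,
      reassoc_of% box_a_incl, Functor.map_comp, reassoc_of% δ₂_nat, tensorHom_comp_tensorHom,
      Hom.h])

lemma boxHom_incl {P Q P' Q' : T.Algebra} (f : P ⟶ P') (g : Q ⟶ Q') :
    (boxHom f g).f ≫ incl P' Q' = incl P Q ≫ (f.f ⊗ₘ g.f) := by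
  simp only [boxHom, homOfIncl, Category.assoc, proj_incl, ← idem_naturality, reassoc_of% incl_idem]

lemma proj_boxHom {P Q P' Q' : T.Algebra} (f : P ⟶ P') (g : Q ⟶ Q') :
    proj P Q ≫ (boxHom f g).f = (f.f ⊗ₘ g.f) ≫ proj P' Q' := by
  rw [← cancel_mono (incl P' Q'), Category.assoc, boxHom_incl, reassoc_of% proj_incl,
    idem_naturality, Category.assoc, proj_incl]

lemma incl_idemLeft (P Q S : T.Algebra) :
    incl P Q ▷ S.A ≫ idemLeft P Q S = idem (box P Q) S ≫ incl P Q ▷ S.A := by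
  simp only [idemLeft, idem, ← tensorHom_id, reassoc_of% unit₂_nat, Category.assoc, Functor.map_id,
    tensorHom_comp_tensorHom, box_a_incl, id_comp, comp_id]

lemma proj_idem_incl_left (P Q S : T.Algebra) :
    proj P Q ▷ S.A ≫ idem (box P Q) S ≫ incl P Q ▷ S.A = idemLeft P Q S := by
  rw [← incl_idemLeft, ← comp_whiskerRight_assoc, proj_incl]
  simp only [idemLeft, ← tensorHom_id, reassoc_of% unit₂_nat, Functor.map_id,
    tensorHom_comp_tensorHom, id_comp, map_idem_a]

lemma incl_idemRight (P Q S : T.Algebra) :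
    P.A ◁ incl Q S ≫ idemRight P Q S = idem P (box Q S) ≫ P.A ◁ incl Q S := by
  simp only [idemRight, idem, ← id_tensorHom, reassoc_of% unit₂_nat, Category.assoc, Functor.map_id,
    tensorHom_comp_tensorHom, box_a_incl, id_comp, comp_id]

lemma proj_idem_incl_right (P Q S : T.Algebra) :
    P.A ◁ proj Q S ≫ idem P (box Q S) ≫ P.A ◁ incl Q S = idemRight P Q S := by
  rw [← incl_idemRight, ← MonoidalCategory.whiskerLeft_comp_assoc, proj_incl]
  simp only [idemRight, ← id_tensorHom, reassoc_of% unit₂_nat, Functor.map_id,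
    tensorHom_comp_tensorHom, id_comp, map_idem_a]

/-- The underlying morphism of the associator `(P □ Q) □ S ⟶ P □ (Q □ S)`. -/
noncomputable def assocHom (P Q S : T.Algebra) : (box (box P Q) S).A ⟶ (box P (box Q S)).A :=
  incl (box P Q) S ≫ incl P Q ▷ S.A ≫ (α_ _ _ _).hom ≫ P.A ◁ proj Q S ≫ proj P (box Q S)

/-- The underlying morphism of the inverse of the associator. -/
noncomputable def assocInv (P Q S : T.Algebra) : (box P (box Q S)).A ⟶ (box (box P Q) S).A :=
  incl P (box Q S) ≫ P.A ◁ incl Q S ≫ (α_ _ _ _).inv ≫ proj P Q ▷ S.A ≫ proj (box P Q) S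

/-- The associator is the restriction of the associator of the underlying objects: both iterated
products are images of the same idempotent on the threefold tensor product. -/
lemma assocHom_incl (P Q S : T.Algebra) :
    assocHom P Q S ≫ incl P (box Q S) ≫ P.A ◁ incl Q S =
      incl (box P Q) S ≫ incl P Q ▷ S.A ≫ (α_ _ _ _).hom := by
  simp only [assocHom, Category.assoc, reassoc_of% proj_incl, proj_idem_incl_right]
  rw [← idemLeft_associator, reassoc_of% incl_idemLeft, reassoc_of% incl_idem]

lemma assocInv_incl (P Q S : T.Algebra) :
    assocInv P Q S ≫ incl (box P Q) S ≫ incl P Q ▷ S.A =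
      incl P (box Q S) ≫ P.A ◁ incl Q S ≫ (α_ _ _ _).inv := by
  have h : (α_ P.A Q.A S.A).inv ≫ idemLeft P Q S = idemRight P Q S ≫ (α_ _ _ _).inv := by
    rw [Iso.inv_comp_eq, ← reassoc_of% idemLeft_associator, Iso.hom_inv_id, comp_id]
  simp only [assocInv, Category.assoc, reassoc_of% proj_incl, proj_idem_incl_left]
  rw [h, reassoc_of% incl_idemRight, reassoc_of% incl_idem]

lemma box_a_incl_left (P Q S : T.Algebra) :
    (box (box P Q) S).a ≫ incl (box P Q) S ≫ incl P Q ▷ S.A =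
      T.map (incl (box P Q) S ≫ incl P Q ▷ S.A) ≫ T.δ₂ (P.A ⊗ Q.A) S.A ≫
        T.δ₂ P.A Q.A ▷ T.obj S.A ≫ ((P.a ⊗ₘ Q.a) ⊗ₘ S.a) := by
  simp only [reassoc_of% box_a_incl, Functor.map_comp, Category.assoc, ← tensorHom_id,
    reassoc_of% δ₂_nat, Functor.map_id, tensorHom_comp_tensorHom, box_a_incl, comp_id, id_comp]

lemma box_a_incl_right (P Q S : T.Algebra) :
    (box P (box Q S)).a ≫ incl P (box Q S) ≫ P.A ◁ incl Q S =
      T.map (incl P (box Q S) ≫ P.A ◁ incl Q S) ≫ T.δ₂ P.A (Q.A ⊗ S.A) ≫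
        T.obj P.A ◁ T.δ₂ Q.A S.A ≫ (P.a ⊗ₘ (Q.a ⊗ₘ S.a)) := by
  simp only [reassoc_of% box_a_incl, Functor.map_comp, Category.assoc, ← id_tensorHom,
    reassoc_of% δ₂_nat, Functor.map_id, tensorHom_comp_tensorHom, box_a_incl, comp_id, id_comp]

/-- The associator of the category of algebras. -/
noncomputable def associator (P Q S : T.Algebra) : box (box P Q) S ≅ box P (box Q S) :=
  isoMk
    { hom := assocHom P Q S
      inv := assocInv P Q S
      hom_inv_id := by
        rw [← cancel_mono (incl (box P Q) S), ← cancel_mono (incl P Q ▷ S.A)]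
        simp only [Category.assoc, assocInv_incl, reassoc_of% assocHom_incl, Iso.hom_inv_id,
          comp_id, id_comp]
      inv_hom_id := by
        rw [← cancel_mono (incl P (box Q S)), ← cancel_mono (P.A ◁ incl Q S)]
        simp only [Category.assoc, assocHom_incl, reassoc_of% assocInv_incl, Iso.inv_hom_id,
          comp_id, id_comp] }
    (by
      rw [← cancel_mono (incl P (box Q S)), ← cancel_mono (P.A ◁ incl Q S)]
      simp only [Category.assoc, assocHom_incl, box_a_incl_right, reassoc_of% box_a_incl_left]
      rw [← Functor.map_comp_assoc, assocHom_incl, associator_naturality, reassoc_of% δ₂_assoc]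
      simp only [Functor.map_comp, Category.assoc])

lemma associator_hom_incl (P Q S : T.Algebra) :
    (associator P Q S).hom.f ≫ incl P (box Q S) ≫ P.A ◁ incl Q S =
      incl (box P Q) S ≫ incl P Q ▷ S.A ≫ (α_ _ _ _).hom :=
  assocHom_incl P Q S

lemma associator_inv_incl (P Q S : T.Algebra) :
    (associator P Q S).inv.f ≫ incl (box P Q) S ≫ incl P Q ▷ S.A =
      incl P (box Q S) ≫ P.A ◁ incl Q S ≫ (α_ _ _ _).inv :=
  assocInv_incl P Q S

/-- The projections to the iterated products are associative. -/
lemma proj_associator (P Q S : T.Algebra) :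
    proj P Q ▷ S.A ≫ proj (box P Q) S ≫ (associator P Q S).hom.f =
      (α_ _ _ _).hom ≫ P.A ◁ proj Q S ≫ proj P (box Q S) := by
  rw [← cancel_mono (incl P (box Q S)), ← cancel_mono (P.A ◁ incl Q S)]
  simp only [Category.assoc, associator_hom_incl, reassoc_of% proj_incl,
    reassoc_of% proj_idem_incl_left, proj_idem_incl_right, idemLeft_associator]

lemma boxHom_associator {P Q S P' Q' S' : T.Algebra} (f : P ⟶ P') (g : Q ⟶ Q')
    (h : S ⟶ S') :
    boxHom (boxHom f g) h ≫ (associator P' Q' S').hom =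
      (associator P Q S).hom ≫ boxHom f (boxHom g h) := by
  have h1 : ((boxHom f g).f ⊗ₘ h.f) ≫ incl P' Q' ▷ S'.A =
      incl P Q ▷ S.A ≫ ((f.f ⊗ₘ g.f) ⊗ₘ h.f) := by
    simp only [← tensorHom_id, tensorHom_comp_tensorHom, boxHom_incl, comp_id, id_comp]
  have h2 : (f.f ⊗ₘ (boxHom g h).f) ≫ P'.A ◁ incl Q' S' =
      P.A ◁ incl Q S ≫ (f.f ⊗ₘ (g.f ⊗ₘ h.f)) := by
    simp only [← id_tensorHom, tensorHom_comp_tensorHom, boxHom_incl, comp_id, id_comp]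
  ext
  rw [← cancel_mono (incl P' (box Q' S')), ← cancel_mono (P'.A ◁ incl Q' S')]
  simp only [comp_f, Category.assoc, associator_hom_incl, reassoc_of% boxHom_incl]
  rw [reassoc_of% h1, h2, reassoc_of% associator_hom_incl, associator_naturality]

lemma boxHom_id_incl {P P' : T.Algebra} (f : P ⟶ P') (Q : T.Algebra) :
    (boxHom f (𝟙 Q)).f ≫ incl P' Q = incl P Q ≫ f.f ▷ Q.A := by
  rw [boxHom_incl, id_f, tensorHom_id]

lemma id_boxHom_incl (P : T.Algebra) {Q Q' : T.Algebra} (g : Q ⟶ Q') :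
    (boxHom (𝟙 P) g).f ≫ incl P Q' = incl P Q ≫ P.A ◁ g.f := by
  rw [boxHom_incl, id_f, id_tensorHom]

lemma box_pentagon (P Q S U : T.Algebra) :
    boxHom (associator P Q S).hom (𝟙 U) ≫ (associator P (box Q S) U).hom ≫
        boxHom (𝟙 P) (associator Q S U).hom =
      (associator (box P Q) S U).hom ≫ (associator P Q (box S U)).hom := by
  ext
  rw [← cancel_mono (incl P _), ← cancel_mono (P.A ◁ incl Q (box S U)),
    ← cancel_mono (P.A ◁ Q.A ◁ incl S U)]
  simp only [comp_f, Category.assoc, reassoc_of% id_boxHom_incl, reassoc_of% associator_hom_incl]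
  rw [← MonoidalCategory.whiskerLeft_comp, ← MonoidalCategory.whiskerLeft_comp,
    associator_hom_incl]
  simp only [MonoidalCategory.whiskerLeft_comp, reassoc_of% associator_hom_incl]
  rw [reassoc_of% boxHom_id_incl, ← associator_naturality_middle_assoc, ← comp_whiskerRight_assoc,
    ← comp_whiskerRight_assoc,
    Category.assoc, associator_hom_incl]
  simp only [comp_whiskerRight, Category.assoc, pentagon]
  rw [← associator_naturality_right, ← whisker_exchange_assoc, reassoc_of% associator_hom_incl,
    associator_naturality_left_assoc]

end Algebra

end CategoryTheory.Monad

/-! ### The Frobenius conditions -/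

namespace CategoryTheory.Monad

open CategoryTheory Category MonoidalCategory

variable {C : Type u} [Category.{v} C] [MonoidalCategory C] (T : Monad C)
  [T.toFunctor.OplaxMonoidal]

/-- The unit of the monad `T` is weakly opmonoidal: the iterate of `T_2` composed with the unit is
obtained, in either of the two possible orders, from two copies of `T_2.η`. -/
class WeaklyUnital : Prop where
  right (X Y Z : C) : (α_ X Y Z).hom ≫ X ◁ T.unit₂ Y Z ≫ (α_ _ _ _).inv ≫
    T.unit₂ X (T.obj Y) ▷ T.obj Z ≫ (T.obj X ◁ T.mul Y) ▷ T.obj Z =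
      T.unit₂ (X ⊗ Y) Z ≫ T.δ₂ X Y ▷ T.obj Z
  left (X Y Z : C) : (α_ X Y Z).inv ≫ T.unit₂ X Y ▷ Z ≫ (α_ _ _ _).hom ≫
    T.obj X ◁ T.unit₂ (T.obj Y) Z ≫ T.obj X ◁ T.mul Y ▷ T.obj Z =
      T.unit₂ X (Y ⊗ Z) ≫ T.obj X ◁ T.δ₂ Y Z

variable {T} [T.WeaklyUnital]

namespace Algebra

/-- The weak unitality of `T` factorizes the idempotent of the threefold product into those of
the twofold products. -/
lemma idemRight_eq (P Q S : T.Algebra) :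
    idemRight P Q S = (α_ _ _ _).inv ≫ idem P Q ▷ S.A ≫ (α_ _ _ _).hom ≫ P.A ◁ idem Q S := by
  have h1 : (P.a ⊗ₘ Q.a) ▷ S.A = ((P.a ⊗ₘ Q.a) ⊗ₘ 𝟙 S.A) := (tensorHom_id _ _).symm
  rw [idemRight, ← Category.assoc, ← WeaklyUnital.left]
  simp only [Category.assoc]
  rw [idem, comp_whiskerRight_assoc, h1, associator_naturality_assoc]
  congr 3
  simp only [← id_tensorHom, ← tensorHom_id, tensorHom_comp_tensorHom, idem, id_comp,
    tensorHom_comp_tensorHom, reassoc_of% unit₂_nat, comp_id, Functor.map_id, Q.assoc]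

lemma idemLeft_eq (P Q S : T.Algebra) :
    idemLeft P Q S = (α_ _ _ _).hom ≫ P.A ◁ idem Q S ≫ (α_ _ _ _).inv ≫ idem P Q ▷ S.A := by
  have h1 : P.A ◁ (Q.a ⊗ₘ S.a) = (𝟙 P.A ⊗ₘ (Q.a ⊗ₘ S.a)) := (id_tensorHom _ _).symm
  rw [idemLeft, ← Category.assoc, ← WeaklyUnital.right]
  simp only [Category.assoc]
  rw [idem, MonoidalCategory.whiskerLeft_comp_assoc, h1, associator_inv_naturality_assoc]
  congr 3
  simp only [← id_tensorHom, ← tensorHom_id, tensorHom_comp_tensorHom, idem, id_comp,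
    tensorHom_comp_tensorHom, reassoc_of% unit₂_nat, comp_id, Functor.map_id, Q.assoc]

variable [T.MulOpmonoidal] [IsIdempotentComplete C]

lemma frobenius_left (P Q S : T.Algebra) :
    incl P Q ▷ S.A ≫ (α_ _ _ _).hom ≫ P.A ◁ proj Q S =
      proj (box P Q) S ≫ (associator P Q S).hom.f ≫ incl P (box Q S) := by
  rw [← cancel_mono (P.A ◁ incl Q S)]
  simp only [Category.assoc, associator_hom_incl, reassoc_of% proj_incl]
  rw [← reassoc_of% incl_idemLeft, idemLeft_associator, idemRight_eq,
    ← MonoidalCategory.whiskerLeft_comp, proj_incl, Iso.hom_inv_id_assoc,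
    ← comp_whiskerRight_assoc, incl_idem]

lemma frobenius_right (P Q S : T.Algebra) :
    P.A ◁ incl Q S ≫ (α_ _ _ _).inv ≫ proj P Q ▷ S.A =
      proj P (box Q S) ≫ (associator P Q S).inv.f ≫ incl (box P Q) S := by
  have h : (α_ P.A Q.A S.A).inv ≫ idemLeft P Q S = idemRight P Q S ≫ (α_ _ _ _).inv := by
    rw [Iso.inv_comp_eq, ← reassoc_of% idemLeft_associator, Iso.hom_inv_id, comp_id]
  rw [← cancel_mono (incl P Q ▷ S.A)]
  simp only [Category.assoc, associator_inv_incl, reassoc_of% proj_incl]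
  rw [← reassoc_of% incl_idemRight, ← h, idemLeft_eq, ← comp_whiskerRight, proj_incl,
    Iso.inv_hom_id_assoc, ← MonoidalCategory.whiskerLeft_comp_assoc, incl_idem]

end Algebra

end CategoryTheory.Monad

/-! ### The unit object of the category of algebras -/

namespace CategoryTheory.Monad

open CategoryTheory Category MonoidalCategory

variable {C : Type u} [Category.{v} C] [MonoidalCategory C] (T : Monad C)
  [T.toFunctor.OplaxMonoidal]

/-- The morphism `T_0.μ : T T K ⟶ K`, for the monoidal unit `K`. -/
abbrev counitμ : T.obj (T.obj (𝟙_ C)) ⟶ 𝟙_ C := T.mul (𝟙_ C) ≫ T.δ₀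

/-- The morphism `(a ⊗ x) h ↦ ε(a h₁) x h₂` in Sweedler notation. -/
def cutLeft (X : C) : T.obj (T.obj (𝟙_ C) ⊗ X) ⟶ T.obj X :=
  T.δ₂ (T.obj (𝟙_ C)) X ≫ T.counitμ ▷ T.obj X ≫ (λ_ _).hom

/-- The morphism `(x ⊗ a) h ↦ x h₁ ε(a h₂)` in Sweedler notation. -/
def cutRight (X : C) : T.obj (X ⊗ T.obj (𝟙_ C)) ⟶ T.obj X :=
  T.δ₂ X (T.obj (𝟙_ C)) ≫ T.obj X ◁ T.counitμ ≫ (ρ_ _).hom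

/-- The morphism `a ⊗ b ↦ ε(a b₁) b₂`. -/
abbrev cutLeftUnit : T.obj (T.obj (𝟙_ C)) ⟶ T.obj (𝟙_ C) :=
  T.map (ρ_ _).inv ≫ T.cutLeft (𝟙_ C)

/-- The morphism `a ⊗ b ↦ b₁ ε(a b₂)`. -/
abbrev cutRightUnit : T.obj (T.obj (𝟙_ C)) ⟶ T.obj (𝟙_ C) :=
  T.map (λ_ _).inv ≫ T.cutRight (𝟙_ C)

/-- The counit of `T` is weakly multiplicative. In Sweedler notation,
`ε(a b₁) ε(b₂ c) = ε(a b c) = ε(a b₂) ε(b₁ c)`. -/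
class WeaklyCounital : Prop where
  left : T.map T.cutLeftUnit ≫ T.counitμ = T.mul (T.obj (𝟙_ C)) ≫ T.counitμ
  right : T.map T.cutRightUnit ≫ T.counitμ = T.mul (T.obj (𝟙_ C)) ≫ T.counitμ

/-- The idempotent `a ↦ 1₁ ε(a 1₂)` on `T K`, whose image is the unit object. -/
def unitIdem : T.obj (𝟙_ C) ⟶ T.obj (𝟙_ C) := T.η.app _ ≫ T.cutRightUnit

/-- The idempotent `a ↦ ε(a 1₁) 1₂` on `T K`. -/
def unitIdemLeft : T.obj (𝟙_ C) ⟶ T.obj (𝟙_ C) := T.η.app _ ≫ T.cutLeftUnit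

variable {T}

/-- Two elements of `T K` have the same image under the idempotent `a ↦ 1₁ ε(a 1₂)` if they define
the same functional `ε(a -)`. -/
lemma comp_unitIdem_ext {X : C} {f g : X ⟶ T.obj (𝟙_ C)}
    (h : T.map f ≫ T.counitμ = T.map g ≫ T.counitμ) : f ≫ T.unitIdem = g ≫ T.unitIdem := by
  have key (f : X ⟶ T.obj (𝟙_ C)) : f ≫ T.unitIdem = T.η.app X ≫ T.map (λ_ X).inv ≫
      T.δ₂ (𝟙_ C) X ≫ T.obj (𝟙_ C) ◁ (T.map f ≫ T.counitμ) ≫ (ρ_ _).hom := by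
    rw [unitIdem, reassoc_of% η_nat, cutRightUnit, cutRight, ← Functor.map_comp_assoc,
      leftUnitor_inv_naturality, Functor.map_comp_assoc, reassoc_of% δ₂_nat_right,
      ← MonoidalCategory.whiskerLeft_comp_assoc]
  rw [key, key, h]

section

variable [T.WeaklyCounital]

lemma map_unitIdem_counitμ : T.map T.unitIdem ≫ T.counitμ = T.counitμ := by
  rw [unitIdem, Functor.map_comp, Category.assoc, WeaklyCounital.right, reassoc_of% T.map_η_μ]

lemma map_unitIdemLeft_counitμ : T.map T.unitIdemLeft ≫ T.counitμ = T.counitμ := by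
  rw [unitIdemLeft, Functor.map_comp, Category.assoc, WeaklyCounital.left, reassoc_of% T.map_η_μ]

/-- `ε(a b₁) b₂` and `a b` have the same image in the unit object. -/
lemma cutLeft_unitIdem : T.cutLeftUnit ≫ T.unitIdem = T.mul _ ≫ T.unitIdem :=
  comp_unitIdem_ext (by rw [WeaklyCounital.left, reassoc_of% T.map_μ])

/-- `b₁ ε(a b₂)` and `a b` have the same image in the unit object. -/
lemma cutRight_unitIdem : T.cutRightUnit ≫ T.unitIdem = T.mul _ ≫ T.unitIdem :=
  comp_unitIdem_ext (by rw [WeaklyCounital.right, reassoc_of% T.map_μ])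

lemma map_unitIdem_μ_unitIdem :
    T.map T.unitIdem ≫ T.mul _ ≫ T.unitIdem = T.mul _ ≫ T.unitIdem := by
  rw [← Category.assoc]
  refine comp_unitIdem_ext ?_
  rw [Functor.map_comp, Category.assoc, reassoc_of% T.map_μ, reassoc_of% μ_nat,
    map_unitIdem_counitμ]

variable (T) in
/-- The nonunital algebra `T K`, whose action is `a ⊗ b ↦ 1₁ ε(a b 1₂)`. -/
def unitNonunital : NonunitalAlgebra T where
  A := T.obj (𝟙_ C)
  a := T.mul _ ≫ T.unitIdem
  assoc := by
    rw [Functor.map_comp_assoc, map_unitIdem_μ_unitIdem, reassoc_of% T.map_μ]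

end

/-- The counit property `ε(1₁) 1₂ = 1`. -/
lemma unit₂_counit_left (X : C) : T.unit₂ (𝟙_ C) X ≫ T.δ₀ ▷ T.obj X =
    (λ_ X).hom ≫ T.η.app X ≫ (λ_ _).inv := by
  rw [← Iso.inv_comp_eq, unit₂, Category.assoc, reassoc_of% η_nat, δ₂_counit_left]

/-- The counit property `1₁ ε(1₂) = 1`. -/
lemma unit₂_counit_right (X : C) : T.unit₂ X (𝟙_ C) ≫ T.obj X ◁ T.δ₀ =
    (ρ_ X).hom ≫ T.η.app X ≫ (ρ_ _).inv := by
  rw [← Iso.inv_comp_eq, unit₂, Category.assoc, reassoc_of% η_nat, δ₂_counit_right]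

/-- The morphism `a ⊗ x ↦ ε(a 1₁) x 1₂`. -/
def unitCutLeft (X : C) : T.obj (𝟙_ C) ⊗ X ⟶ T.obj X := T.η.app _ ≫ T.cutLeft X

/-- The morphism `x ⊗ a ↦ x 1₁ ε(a 1₂)`. -/
def unitCutRight (X : C) : X ⊗ T.obj (𝟙_ C) ⟶ T.obj X := T.η.app _ ≫ T.cutRight X

lemma unitCutLeft_eq (X : C) :
    T.unitCutLeft X = T.unit₂ (T.obj (𝟙_ C)) X ≫ T.counitμ ▷ T.obj X ≫ (λ_ _).hom := by
  rw [unitCutLeft, cutLeft, unit₂, Category.assoc]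

lemma unitCutRight_eq (X : C) :
    T.unitCutRight X = T.unit₂ X (T.obj (𝟙_ C)) ≫ T.obj X ◁ T.counitμ ≫ (ρ_ _).hom := by
  rw [unitCutRight, cutRight, unit₂, Category.assoc]

/-- `ε(a 1₁) 1₂ ⊗ x 1₃ = ε(a 1₁) 1₂ 1'₁ ⊗ x 1'₂`. -/
lemma unitCutLeft_comul [T.WeaklyUnital] (X : C) :
    T.unitCutLeft X ≫ T.map (λ_ X).inv ≫ T.δ₂ _ _ =
      T.unitIdemLeft ▷ X ≫ T.unit₂ (T.obj (𝟙_ C)) X ≫ T.mul _ ▷ T.obj X := by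
  have h0 : T.unitIdemLeft = (ρ_ _).inv ≫ T.unit₂ (T.obj (𝟙_ C)) (𝟙_ C) ≫
      T.counitμ ▷ T.obj (𝟙_ C) ≫ (λ_ _).hom := by
    rw [unitIdemLeft, ← reassoc_of% η_nat, ← unitCutLeft_eq, unitCutLeft]
  have h2 : T.unitCutLeft X ≫ T.map (λ_ X).inv ≫ T.δ₂ _ _ =
      T.obj (𝟙_ C) ◁ (λ_ X).inv ≫
      (T.unit₂ (T.obj (𝟙_ C)) (𝟙_ C ⊗ X) ≫ T.obj (T.obj (𝟙_ C)) ◁ T.δ₂ (𝟙_ C) X) ≫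
        T.counitμ ▷ _ ≫ (λ_ _).hom := by
    rw [unitCutLeft_eq]
    simp only [Category.assoc, reassoc_of% unit₂_nat_right, whisker_exchange_assoc,
      leftUnitor_naturality, leftUnitor_naturality_assoc]
  have h3 : T.obj (𝟙_ C) ◁ (λ_ X).inv ≫ (α_ _ _ _).inv = (ρ_ (T.obj (𝟙_ C))).inv ▷ X := by
    monoidal
  rw [h2, ← WeaklyUnital.left, h0]
  simp only [Category.assoc, whisker_exchange_assoc, leftUnitor_naturality]
  rw [reassoc_of% h3, ← associator_naturality_left_assoc, leftUnitor_naturality_assoc,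
    leftUnitor_tensor_hom_assoc, Iso.hom_inv_id_assoc]
  simp only [comp_whiskerRight, Category.assoc]

/-- `x 1₁ ⊗ 1₂ ε(a 1₃) = x 1'₁ ⊗ 1₁ 1'₂ ε(a 1₂)`. -/
lemma unitCutRight_comul [T.WeaklyUnital] (X : C) :
    T.unitCutRight X ≫ T.map (ρ_ X).inv ≫ T.δ₂ _ _ =
      X ◁ T.unitIdem ≫ T.unit₂ X (T.obj (𝟙_ C)) ≫ T.obj X ◁ T.mul _ := by
  have h0 : T.unitIdem = (λ_ _).inv ≫ T.unit₂ (𝟙_ C) (T.obj (𝟙_ C)) ≫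
      T.obj (𝟙_ C) ◁ T.counitμ ≫ (ρ_ _).hom := by
    rw [unitIdem, ← reassoc_of% η_nat, ← unitCutRight_eq, unitCutRight]
  have h2 : T.unitCutRight X ≫ T.map (ρ_ X).inv ≫ T.δ₂ _ _ =
      (ρ_ X).inv ▷ T.obj (𝟙_ C) ≫
      (T.unit₂ (X ⊗ 𝟙_ C) (T.obj (𝟙_ C)) ≫ T.δ₂ X (𝟙_ C) ▷ T.obj (T.obj (𝟙_ C))) ≫
        _ ◁ T.counitμ ≫ (ρ_ _).hom := by
    rw [unitCutRight_eq]
    simp only [Category.assoc, reassoc_of% unit₂_nat_left, ← whisker_exchange_assoc,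
      rightUnitor_naturality, rightUnitor_naturality_assoc]
  have h3 : (ρ_ X).inv ▷ T.obj (𝟙_ C) ≫ (α_ _ _ _).hom = X ◁ (λ_ (T.obj (𝟙_ C))).inv := by
    monoidal
  rw [h2, ← WeaklyUnital.right, h0]
  simp only [Category.assoc, ← whisker_exchange_assoc, rightUnitor_naturality]
  rw [reassoc_of% h3, ← associator_inv_naturality_right_assoc, rightUnitor_naturality_assoc,
    rightUnitor_tensor_hom_assoc, Iso.inv_hom_id_assoc]
  simp only [MonoidalCategory.whiskerLeft_comp, Category.assoc]

/-- `x 1₁ h₁ ⊗ y 1₂ h₂ = x h₁ ⊗ y h₂`. -/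
lemma map_unit₂_δ₂_mul [T.MulOpmonoidal] (X Y : C) :
    T.map (T.unit₂ X Y) ≫ T.δ₂ (T.obj X) (T.obj Y) ≫ (T.mul X ⊗ₘ T.mul Y) = T.δ₂ X Y := by
  rw [unit₂, Functor.map_comp, Category.assoc, ← MulOpmonoidal.μ_δ₂, reassoc_of% map_η_μ]

/-- `ε(a 1₁) x 1₂ h = ε(a h₁) x h₂`. -/
lemma map_unitCutLeft_mul [T.MulOpmonoidal] [T.WeaklyUnital] [T.WeaklyCounital] (X : C) :
    T.map (T.unitCutLeft X) ≫ T.mul X = T.cutLeft X := by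
  have h1 : T.mul X = T.map (T.map (λ_ X).inv ≫ T.δ₂ _ _) ≫ T.δ₂ _ _ ≫
      (T.mul (𝟙_ C) ⊗ₘ T.mul X) ≫ T.δ₀ ▷ T.obj X ≫ (λ_ _).hom := by
    rw [Functor.map_comp_assoc, ← reassoc_of% MulOpmonoidal.μ_δ₂, reassoc_of% μ_nat,
      reassoc_of% δ₂_counit_left, Iso.inv_hom_id, comp_id]
  have h2 : T.map (T.mul (𝟙_ C)) ▷ T.obj (T.obj X) ≫ (T.mul (𝟙_ C) ⊗ₘ T.mul X) =
      (T.mul (T.obj (𝟙_ C)) ⊗ₘ T.mul X) ≫ T.mul (𝟙_ C) ▷ T.obj X := by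
    simp only [← tensorHom_id, tensorHom_comp_tensorHom, map_μ, id_comp, comp_id]
  -- expand `h` as `ε(h₁) h₂`, move one more coproduct of the unit past it and contract
  rw [h1, ← Functor.map_comp_assoc, unitCutLeft_comul]
  simp only [Functor.map_comp, Category.assoc]
  rw [reassoc_of% δ₂_nat_left, reassoc_of% h2, reassoc_of% map_unit₂_δ₂_mul,
    ← comp_whiskerRight_assoc, reassoc_of% δ₂_nat_left, ← comp_whiskerRight_assoc,
    map_unitIdemLeft_counitμ, cutLeft]

/-- `x 1₁ h ε(a 1₂) = x h₁ ε(a h₂)`. -/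
lemma map_unitCutRight_mul [T.MulOpmonoidal] [T.WeaklyUnital] [T.WeaklyCounital] (X : C) :
    T.map (T.unitCutRight X) ≫ T.mul X = T.cutRight X := by
  have h1 : T.mul X = T.map (T.map (ρ_ X).inv ≫ T.δ₂ _ _) ≫ T.δ₂ _ _ ≫
      (T.mul X ⊗ₘ T.mul (𝟙_ C)) ≫ T.obj X ◁ T.δ₀ ≫ (ρ_ _).hom := by
    rw [Functor.map_comp_assoc, ← reassoc_of% MulOpmonoidal.μ_δ₂, reassoc_of% μ_nat,
      reassoc_of% δ₂_counit_right, Iso.inv_hom_id, comp_id]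
  have h2 : T.obj (T.obj X) ◁ T.map (T.mul (𝟙_ C)) ≫ (T.mul X ⊗ₘ T.mul (𝟙_ C)) =
      (T.mul X ⊗ₘ T.mul (T.obj (𝟙_ C))) ≫ T.obj X ◁ T.mul (𝟙_ C) := by
    simp only [← id_tensorHom, tensorHom_comp_tensorHom, map_μ, id_comp, comp_id]
  rw [h1, ← Functor.map_comp_assoc, unitCutRight_comul]
  simp only [Functor.map_comp, Category.assoc]
  rw [reassoc_of% δ₂_nat_right, reassoc_of% h2, reassoc_of% map_unit₂_δ₂_mul,
    ← MonoidalCategory.whiskerLeft_comp_assoc, reassoc_of% δ₂_nat_right,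
    ← MonoidalCategory.whiskerLeft_comp_assoc, map_unitIdem_counitμ, cutRight]

section

variable [T.MulOpmonoidal] [T.WeaklyUnital] [T.WeaklyCounital]

/-- `ε(a 1'₁) 1₁ ⊗ x 1'₂ 1₂ = 1₁ ε(a 1₂) ⊗ x 1₃`. -/
lemma unitCutLeft_unit₂ (X : C) :
    T.unitCutLeft X ≫ (λ_ _).inv ≫ T.unit₂ (𝟙_ C) (T.obj X) ≫ T.obj (𝟙_ C) ◁ T.mul X =
      T.unit₂ (T.obj (𝟙_ C)) X ≫ T.cutRightUnit ▷ T.obj X := by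
  have h : T.obj (𝟙_ C) ◁ T.counitμ ▷ T.obj X ≫ T.obj (𝟙_ C) ◁ (λ_ _).hom =
      (α_ _ _ _).inv ≫ (T.obj (𝟙_ C) ◁ T.counitμ) ▷ T.obj X ≫ (ρ_ _).hom ▷ T.obj X := by
    simp
  have h' : (λ_ (T.obj (𝟙_ C) ⊗ X)).inv ≫ (α_ _ _ _).inv = (λ_ (T.obj (𝟙_ C))).inv ▷ X := by
    monoidal
  rw [leftUnitor_inv_naturality_assoc, reassoc_of% unit₂_nat_right,
    ← MonoidalCategory.whiskerLeft_comp, map_unitCutLeft_mul, cutLeft]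
  simp only [MonoidalCategory.whiskerLeft_comp]
  rw [h, reassoc_of% unit₂_assoc_inv, Iso.hom_inv_id_assoc, reassoc_of% h',
    reassoc_of% unit₂_nat_left, cutRightUnit, cutRight]
  simp only [comp_whiskerRight]

/-- `x 1'₁ 1₁ ⊗ 1₂ ε(a 1'₂) = x 1₁ ⊗ ε(a 1₂) 1₃`. -/
lemma unitCutRight_unit₂ (X : C) :
    T.unitCutRight X ≫ (ρ_ _).inv ≫ T.unit₂ (T.obj X) (𝟙_ C) ≫ T.mul X ▷ T.obj (𝟙_ C) =
      T.unit₂ X (T.obj (𝟙_ C)) ≫ T.obj X ◁ T.cutLeftUnit := by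
  have h : (T.obj X ◁ T.counitμ) ▷ T.obj (𝟙_ C) ≫ (ρ_ _).hom ▷ T.obj (𝟙_ C) =
      (α_ _ _ _).hom ≫ T.obj X ◁ T.counitμ ▷ T.obj (𝟙_ C) ≫ T.obj X ◁ (λ_ _).hom := by
    simp
  have h' : (ρ_ (X ⊗ T.obj (𝟙_ C))).inv ≫ (α_ _ _ _).hom = X ◁ (ρ_ (T.obj (𝟙_ C))).inv := by
    monoidal
  rw [rightUnitor_inv_naturality_assoc, reassoc_of% unit₂_nat_left, ← comp_whiskerRight,
    map_unitCutRight_mul, cutRight]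
  simp only [comp_whiskerRight]
  rw [h, reassoc_of% unit₂_assoc, reassoc_of% h', reassoc_of% unit₂_nat_right, cutLeftUnit, cutLeft]
  simp only [MonoidalCategory.whiskerLeft_comp]

end

end CategoryTheory.Monad

/-! ### The monoidal category of algebras and the weak bimonad -/

namespace CategoryTheory.Monad

open CategoryTheory Category MonoidalCategory

variable {C : Type u} [Category.{v} C] [MonoidalCategory C] (T : Monad C)
  [T.toFunctor.OplaxMonoidal] [T.WeaklyCounital] [IsIdempotentComplete C]

/-- The unit object of the category of algebras. -/
noncomputable def unitAlgebra : T.Algebra := T.unitNonunital.split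

/-- The inclusion of the unit object in `T K`. -/
noncomputable def unitIncl : T.unitAlgebra.A ⟶ T.obj (𝟙_ C) := T.unitNonunital.ι

/-- The projection of `T K` to the unit object. -/
noncomputable def unitProj : T.obj (𝟙_ C) ⟶ T.unitAlgebra.A := T.unitNonunital.π

lemma unitIncl_unitProj : T.unitIncl ≫ T.unitProj = 𝟙 _ := T.unitNonunital.ι_π

lemma unitProj_unitIncl : T.unitProj ≫ T.unitIncl = T.unitIdem := by
  refine T.unitNonunital.π_ι.trans ?_
  rw [NonunitalAlgebra.idem]
  exact (reassoc_of% T.η_μ) _ _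

lemma unitIdem_unitProj : T.unitIdem ≫ T.unitProj = T.unitProj := by
  rw [← unitProj_unitIncl, Category.assoc, unitIncl_unitProj, comp_id]

/-- The projection `T K ⟶ R` is a morphism of algebras. -/
lemma map_unitProj_a : T.map T.unitProj ≫ T.unitAlgebra.a = T.mul _ ≫ T.unitProj := by
  refine T.unitNonunital.map_π_split_a.trans ?_
  refine (Category.assoc _ _ _).trans ?_
  exact congrArg _ T.unitIdem_unitProj

instance : IsSplitEpi T.unitProj := IsSplitEpi.mk' ⟨T.unitIncl, T.unitIncl_unitProj⟩

/-- The counit of the unit object, which is the nullary part of the opmonoidal structure of the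
forgetful functor. -/
noncomputable def unitCounit : T.unitAlgebra.A ⟶ 𝟙_ C := T.unitIncl ≫ T.δ₀

/-- The unit of the unit object, which is the nullary part of the monoidal structure of the
forgetful functor. -/
noncomputable def unitUnit : 𝟙_ C ⟶ T.unitAlgebra.A := T.η.app (𝟙_ C) ≫ T.unitProj

/-- `1₁ ε(a 1₂)` has the counit `ε(a)`. -/
lemma unitProj_unitCounit : T.unitProj ≫ T.unitCounit = T.δ₀ := by
  have h : T.cutRightUnit ≫ T.δ₀ = T.counitμ := by
    rw [cutRightUnit, cutRight, Category.assoc, Category.assoc, Category.assoc,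
      ← rightUnitor_naturality, whisker_exchange_assoc, reassoc_of% δ₂_counit_left,
      ← leftUnitor_inv_naturality_assoc, ← unitors_equal, Iso.inv_hom_id, comp_id]
  rw [unitCounit, reassoc_of% unitProj_unitIncl, unitIdem, Category.assoc, h, reassoc_of% η_μ]

lemma cutRightUnit_unitProj : T.cutRightUnit ≫ T.unitProj = T.mul _ ≫ T.unitProj := by
  rw [← unitIdem_unitProj, ← Category.assoc, cutRight_unitIdem, Category.assoc]

lemma cutLeftUnit_unitProj : T.cutLeftUnit ≫ T.unitProj = T.mul _ ≫ T.unitProj := by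
  rw [← unitIdem_unitProj, ← Category.assoc, cutLeft_unitIdem, Category.assoc]

namespace Algebra

variable {T}

/-- On `R ⊗ P`, the idempotent sends `a ⊗ p` to `a 1₁ ⊗ p 1₂`, computed with `a` in `T K`. -/
lemma unitProj_idem_left (P : T.Algebra) :
    T.unitProj ▷ P.A ≫ idem T.unitAlgebra P =
      T.unit₂ (T.obj (𝟙_ C)) P.A ≫ ((T.mul _ ≫ T.unitProj) ⊗ₘ P.a) := by
  rw [idem, reassoc_of% unit₂_nat_left, ← tensorHom_id, tensorHom_comp_tensorHom, map_unitProj_a,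
    id_comp]

lemma unitProj_idem_right (P : T.Algebra) :
    P.A ◁ T.unitProj ≫ idem P T.unitAlgebra =
      T.unit₂ P.A (T.obj (𝟙_ C)) ≫ (P.a ⊗ₘ (T.mul _ ≫ T.unitProj)) := by
  rw [idem, reassoc_of% unit₂_nat_right, ← id_tensorHom, tensorHom_comp_tensorHom, map_unitProj_a,
    id_comp]

lemma unitUnit_idem_left (P : T.Algebra) :
    T.unitUnit ▷ P.A ≫ idem T.unitAlgebra P = T.unit₂ (𝟙_ C) P.A ≫ (T.unitProj ⊗ₘ P.a) := by
  rw [unitUnit, comp_whiskerRight_assoc, unitProj_idem_left, reassoc_of% unit₂_nat_left,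
    ← tensorHom_id, tensorHom_comp_tensorHom, id_comp, reassoc_of% map_η_μ]

lemma unitUnit_idem_right (P : T.Algebra) :
    P.A ◁ T.unitUnit ≫ idem P T.unitAlgebra = T.unit₂ P.A (𝟙_ C) ≫ (P.a ⊗ₘ T.unitProj) := by
  rw [unitUnit, MonoidalCategory.whiskerLeft_comp_assoc, unitProj_idem_right,
    reassoc_of% unit₂_nat_right, ← id_tensorHom, tensorHom_comp_tensorHom, id_comp,
    reassoc_of% map_η_μ]

/-- `(a ⊗ p) ↦ ε(a 1₁) p 1₂`. -/
lemma unitProj_idem_counit_left (P : T.Algebra) :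
    T.unitProj ▷ P.A ≫ idem T.unitAlgebra P ≫ T.unitCounit ▷ P.A ≫ (λ_ _).hom =
      T.unitCutLeft P.A ≫ P.a := by
  rw [reassoc_of% unitProj_idem_left, unitCutLeft_eq, ← tensorHom_id,
    tensorHom_comp_tensorHom_assoc, Category.assoc, unitProj_unitCounit, comp_id,
    tensorHom_def_assoc, leftUnitor_naturality]
  simp only [Category.assoc]

lemma unitProj_idem_counit_right (P : T.Algebra) :
    P.A ◁ T.unitProj ≫ idem P T.unitAlgebra ≫ P.A ◁ T.unitCounit ≫ (ρ_ _).hom =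
      T.unitCutRight P.A ≫ P.a := by
  rw [reassoc_of% unitProj_idem_right, unitCutRight_eq, ← id_tensorHom,
    tensorHom_comp_tensorHom_assoc, Category.assoc, unitProj_unitCounit, comp_id,
    tensorHom_def'_assoc, rightUnitor_naturality]
  simp only [Category.assoc]

variable [T.MulOpmonoidal]

/-- The underlying morphism of the left unitor `R □ P ⟶ P`. -/
noncomputable def leftUnitorHom (P : T.Algebra) : (box T.unitAlgebra P).A ⟶ P.A :=
  incl T.unitAlgebra P ≫ T.unitCounit ▷ P.A ≫ (λ_ _).hom

/-- The underlying morphism of the right unitor `P □ R ⟶ P`. -/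
noncomputable def rightUnitorHom (P : T.Algebra) : (box P T.unitAlgebra).A ⟶ P.A :=
  incl P T.unitAlgebra ≫ P.A ◁ T.unitCounit ≫ (ρ_ _).hom

instance (P Q : T.Algebra) : IsSplitEpi (proj P Q) := IsSplitEpi.mk' ⟨incl P Q, incl_proj P Q⟩

instance {X Y : C} (f : X ⟶ Y) [IsSplitEpi f] (Z : C) : IsSplitEpi (f ▷ Z) :=
  inferInstanceAs (IsSplitEpi ((tensorRight Z).map f))

instance {X Y : C} (f : X ⟶ Y) [IsSplitEpi f] (Z : C) : IsSplitEpi (Z ◁ f) :=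
  inferInstanceAs (IsSplitEpi ((tensorLeft Z).map f))

lemma unitUnit_leftUnitorHom (P : T.Algebra) :
    T.unitUnit ▷ P.A ≫ proj T.unitAlgebra P ≫ leftUnitorHom P = (λ_ _).hom := by
  rw [leftUnitorHom, reassoc_of% proj_incl, reassoc_of% unitUnit_idem_left, ← tensorHom_id,
    tensorHom_comp_tensorHom_assoc, unitProj_unitCounit, comp_id, tensorHom_def_assoc,
    leftUnitor_naturality, reassoc_of% unit₂_counit_left, Iso.inv_hom_id_assoc, P.unit]
  exact comp_id _

lemma unitUnit_rightUnitorHom (P : T.Algebra) :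
    P.A ◁ T.unitUnit ≫ proj P T.unitAlgebra ≫ rightUnitorHom P = (ρ_ _).hom := by
  rw [rightUnitorHom, reassoc_of% proj_incl, reassoc_of% unitUnit_idem_right, ← id_tensorHom,
    tensorHom_comp_tensorHom_assoc, unitProj_unitCounit, comp_id, tensorHom_def'_assoc,
    rightUnitor_naturality, reassoc_of% unit₂_counit_right, Iso.inv_hom_id_assoc, P.unit]
  exact comp_id _

variable [T.WeaklyUnital]

lemma map_leftUnitorHom_a (P : T.Algebra) :
    T.map (leftUnitorHom P) ≫ P.a = (box T.unitAlgebra P).a ≫ leftUnitorHom P := by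
  rw [← cancel_epi (T.map (proj T.unitAlgebra P)), ← cancel_epi (T.map (T.unitProj ▷ P.A))]
  have h1 : T.map (T.unitProj ▷ P.A) ≫ T.map (proj T.unitAlgebra P) ≫ T.map (leftUnitorHom P) =
      T.map (T.unitCutLeft P.A ≫ P.a) := by
    rw [← unitProj_idem_counit_left, leftUnitorHom, ← Functor.map_comp, ← Functor.map_comp,
      reassoc_of% proj_incl]
  rw [reassoc_of% h1, Functor.map_comp, Category.assoc, ← P.assoc, reassoc_of% map_unitCutLeft_mul,
    leftUnitorHom, reassoc_of% box_a_incl, ← Functor.map_comp_assoc T.toFunctor (proj _ _),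
    proj_incl, reassoc_of% map_idem_a, reassoc_of% δ₂_nat_left, ← tensorHom_id, ← tensorHom_id,
    tensorHom_comp_tensorHom_assoc, tensorHom_comp_tensorHom_assoc, map_unitProj_a, Category.assoc,
    unitProj_unitCounit, id_comp, comp_id, tensorHom_def_assoc, leftUnitor_naturality, cutLeft]
  simp only [Category.assoc]

lemma map_rightUnitorHom_a (P : T.Algebra) :
    T.map (rightUnitorHom P) ≫ P.a = (box P T.unitAlgebra).a ≫ rightUnitorHom P := by
  rw [← cancel_epi (T.map (proj P T.unitAlgebra)), ← cancel_epi (T.map (P.A ◁ T.unitProj))]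
  have h1 : T.map (P.A ◁ T.unitProj) ≫ T.map (proj P T.unitAlgebra) ≫ T.map (rightUnitorHom P) =
      T.map (T.unitCutRight P.A ≫ P.a) := by
    rw [← unitProj_idem_counit_right, rightUnitorHom, ← Functor.map_comp, ← Functor.map_comp,
      reassoc_of% proj_incl]
  rw [reassoc_of% h1, Functor.map_comp, Category.assoc, ← P.assoc, reassoc_of% map_unitCutRight_mul,
    rightUnitorHom, reassoc_of% box_a_incl, ← Functor.map_comp_assoc T.toFunctor (proj _ _),
    proj_incl, reassoc_of% map_idem_a, reassoc_of% δ₂_nat_right, ← id_tensorHom, ← id_tensorHom,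
    tensorHom_comp_tensorHom_assoc, tensorHom_comp_tensorHom_assoc, map_unitProj_a,
    Category.assoc (T.mul _), unitProj_unitCounit, id_comp, comp_id, tensorHom_def'_assoc,
    rightUnitor_naturality, cutRight]
  simp only [Category.assoc]

lemma leftUnitorHom_inv (P : T.Algebra) :
    leftUnitorHom P ≫ (λ_ _).inv ≫ T.unitUnit ▷ P.A ≫ proj T.unitAlgebra P = 𝟙 _ := by
  rw [← cancel_epi (proj T.unitAlgebra P), ← cancel_epi (T.unitProj ▷ P.A),
    ← cancel_mono (incl T.unitAlgebra P)]
  simp only [leftUnitorHom, Category.assoc, reassoc_of% proj_incl, proj_incl, comp_id,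
    unitUnit_idem_left, reassoc_of% unitProj_idem_counit_left]
  -- `ε(a 1'₁) 1₁ ⊗ p 1'₂ 1₂ = 1₁ ε(a 1₂) ⊗ p 1₃`, and for `b = 1₁` the elements `b₁ ε(a b₂)` and
  -- `a b` have the same image in `R`
  have h : (T.obj (𝟙_ C) ◁ T.map P.a) ≫ (T.unitProj ⊗ₘ P.a) =
      (T.obj (𝟙_ C) ◁ T.mul P.A) ≫ (T.unitProj ⊗ₘ P.a) := by
    simp only [← id_tensorHom, tensorHom_comp_tensorHom, P.assoc]
  rw [leftUnitor_inv_naturality_assoc, reassoc_of% unit₂_nat_right, h,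
    reassoc_of% unitCutLeft_unit₂, unitProj_idem_left, ← tensorHom_id, tensorHom_comp_tensorHom,
    id_comp, cutRightUnit_unitProj]

lemma rightUnitorHom_inv (P : T.Algebra) :
    rightUnitorHom P ≫ (ρ_ _).inv ≫ P.A ◁ T.unitUnit ≫ proj P T.unitAlgebra = 𝟙 _ := by
  rw [← cancel_epi (proj P T.unitAlgebra), ← cancel_epi (P.A ◁ T.unitProj),
    ← cancel_mono (incl P T.unitAlgebra)]
  simp only [rightUnitorHom, Category.assoc, reassoc_of% proj_incl, proj_incl, comp_id,
    unitUnit_idem_right, reassoc_of% unitProj_idem_counit_right]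
  have h : (T.map P.a ▷ T.obj (𝟙_ C)) ≫ (P.a ⊗ₘ T.unitProj) =
      (T.mul P.A ▷ T.obj (𝟙_ C)) ≫ (P.a ⊗ₘ T.unitProj) := by
    simp only [← tensorHom_id, tensorHom_comp_tensorHom, P.assoc]
  rw [rightUnitor_inv_naturality_assoc, reassoc_of% unit₂_nat_left, h,
    reassoc_of% unitCutRight_unit₂, unitProj_idem_right, ← id_tensorHom, tensorHom_comp_tensorHom,
    id_comp, cutLeftUnit_unitProj]

/-- The left unitor of the category of algebras. -/
noncomputable def leftUnitor (P : T.Algebra) : box T.unitAlgebra P ≅ P :=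
  isoMk
    { hom := leftUnitorHom P
      inv := (λ_ _).inv ≫ T.unitUnit ▷ P.A ≫ proj T.unitAlgebra P
      hom_inv_id := leftUnitorHom_inv P
      inv_hom_id := by
        simp only [Category.assoc, unitUnit_leftUnitorHom, Iso.inv_hom_id] }
    (map_leftUnitorHom_a P)

/-- The right unitor of the category of algebras. -/
noncomputable def rightUnitor (P : T.Algebra) : box P T.unitAlgebra ≅ P :=
  isoMk
    { hom := rightUnitorHom P
      inv := (ρ_ _).inv ≫ P.A ◁ T.unitUnit ≫ proj P T.unitAlgebra
      hom_inv_id := rightUnitorHom_inv P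
      inv_hom_id := by
        simp only [Category.assoc, unitUnit_rightUnitorHom, Iso.inv_hom_id] }
    (map_rightUnitorHom_a P)

lemma boxHom_leftUnitor {P Q : T.Algebra} (f : P ⟶ Q) :
    boxHom (𝟙 T.unitAlgebra) f ≫ (leftUnitor Q).hom = (leftUnitor P).hom ≫ f := by
  ext
  change (boxHom (𝟙 T.unitAlgebra) f).f ≫ leftUnitorHom Q = leftUnitorHom P ≫ f.f
  rw [leftUnitorHom, leftUnitorHom, reassoc_of% id_boxHom_incl, whisker_exchange_assoc,
    leftUnitor_naturality]
  simp only [Category.assoc]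

lemma boxHom_rightUnitor {P Q : T.Algebra} (f : P ⟶ Q) :
    boxHom f (𝟙 T.unitAlgebra) ≫ (rightUnitor Q).hom = (rightUnitor P).hom ≫ f := by
  ext
  change (boxHom f (𝟙 T.unitAlgebra)).f ≫ rightUnitorHom Q = rightUnitorHom P ≫ f.f
  rw [rightUnitorHom, rightUnitorHom, reassoc_of% boxHom_id_incl, ← whisker_exchange_assoc,
    rightUnitor_naturality]
  simp only [Category.assoc]

lemma box_triangle (P Q : T.Algebra) :
    (associator P T.unitAlgebra Q).hom ≫ boxHom (𝟙 P) (leftUnitor Q).hom =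
      boxHom (rightUnitor P).hom (𝟙 Q) := by
  ext
  rw [← cancel_mono (incl P Q), comp_f, Category.assoc, id_boxHom_incl, boxHom_id_incl]
  change _ ≫ _ ≫ P.A ◁ leftUnitorHom Q = _ ≫ rightUnitorHom P ▷ Q.A
  rw [leftUnitorHom, rightUnitorHom, MonoidalCategory.whiskerLeft_comp,
    reassoc_of% associator_hom_incl]
  simp

variable (T) in
/-- The monoidal structure of the category of algebras. -/
noncomputable abbrev monoidalStruct : MonoidalCategoryStruct T.Algebra where
  tensorObj := box
  whiskerLeft P _ _ g := boxHom (𝟙 P) g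
  whiskerRight f Q := boxHom f (𝟙 Q)
  tensorHom := boxHom
  tensorUnit := T.unitAlgebra
  associator := associator
  leftUnitor := leftUnitor
  rightUnitor := rightUnitor

variable (T) in
/-- The monoidal category of algebras. -/
noncomputable abbrev monoidalCategory : MonoidalCategory T.Algebra :=
  letI := monoidalStruct T
  MonoidalCategory.ofTensorHom
    (id_tensorHom_id := fun P Q => by
      ext
      rw [← cancel_mono (incl P Q)]
      exact (boxHom_id_incl (𝟙 P) Q).trans (by simp))
    (id_tensorHom := fun _ _ _ _ => rfl)
    (tensorHom_id := fun _ _ => rfl)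
    (tensorHom_comp_tensorHom := fun {_ _ _ _ _ R'} f₁ f₂ g₁ g₂ => by
      ext
      rw [← cancel_mono (incl _ _)]
      change ((boxHom f₁ f₂).f ≫ (boxHom g₁ g₂).f) ≫ _ = (boxHom (f₁ ≫ g₁) (f₂ ≫ g₂)).f ≫ _
      rw [Category.assoc, boxHom_incl, reassoc_of% boxHom_incl, boxHom_incl,
        tensorHom_comp_tensorHom]
      rfl)
    (associator_naturality := fun f g h => boxHom_associator f g h)
    (leftUnitor_naturality := fun f => boxHom_leftUnitor f)
    (rightUnitor_naturality := fun f => boxHom_rightUnitor f)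
    (pentagon := box_pentagon)
    (triangle := box_triangle)

end Algebra

variable [T.MulOpmonoidal] [T.WeaklyUnital]

/-- A monad which is opmonoidal as a functor, with a weakly opmonoidal unit and a weakly
multiplicative counit, is a weak bimonad as soon as idempotents split. -/
noncomputable def weakBimonad : WeakBimonad T :=
  letI := Algebra.monoidalCategory T
  letI : T.forget.LaxMonoidal :=
    { ε := T.unitUnit
      μ := Algebra.proj
      μ_natural_left := fun f Q => by
        have := Algebra.proj_boxHom f (𝟙 Q)
        rw [Algebra.id_f, tensorHom_id] at this
        exact this.symm
      μ_natural_right := fun P g => by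
        have := Algebra.proj_boxHom (𝟙 P) g
        rw [Algebra.id_f, id_tensorHom] at this
        exact this.symm
      associativity := Algebra.proj_associator
      left_unitality := fun P => (Algebra.unitUnit_leftUnitorHom P).symm
      right_unitality := fun P => (Algebra.unitUnit_rightUnitorHom P).symm }
  letI : T.forget.OplaxMonoidal :=
    { η := T.unitCounit
      δ := Algebra.incl
      δ_natural_left := fun f Q => (Algebra.boxHom_id_incl f Q).symm
      δ_natural_right := fun P g => (Algebra.id_boxHom_incl P g).symm
      oplax_associativity := fun P Q S => (Algebra.associator_hom_incl P Q S).symm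
      oplax_left_unitality := fun P => by
        have h := congrArg Algebra.Hom.f (Algebra.leftUnitor P).inv_hom_id
        change (Algebra.leftUnitor P).inv.f ≫ Algebra.incl T.unitAlgebra P ≫
          T.unitCounit ▷ P.A ≫ (λ_ P.A).hom = 𝟙 P.A at h
        rw [← Category.assoc, ← Category.assoc, Iso.comp_hom_eq_id] at h
        exact h.symm.trans (Category.assoc _ _ _)
      oplax_right_unitality := fun P => by
        have h := congrArg Algebra.Hom.f (Algebra.rightUnitor P).inv_hom_id
        change (Algebra.rightUnitor P).inv.f ≫ Algebra.incl P T.unitAlgebra ≫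
          P.A ◁ T.unitCounit ≫ (ρ_ P.A).hom = 𝟙 P.A at h
        rw [← Category.assoc, ← Category.assoc, Iso.comp_hom_eq_id] at h
        exact h.symm.trans (Category.assoc _ _ _) }
  { algebraMonoidal := inferInstance
    forgetLax := inferInstance
    forgetOplax := inferInstance
    separableFrobenius :=
      { frobenius_left := Algebra.frobenius_left
        frobenius_right := Algebra.frobenius_right
        separable := fun P Q => Algebra.incl_proj P Q } }

omit [MonoidalCategory C] [T.toFunctor.OplaxMonoidal] [T.WeaklyCounital]
  [IsIdempotentComplete C] [T.MulOpmonoidal] [T.WeaklyUnital] in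
lemma adj_homEquiv_symm_f {X : C} {P : T.Algebra} (f : X ⟶ P.A) :
    ((T.adj.homEquiv X P).symm f).f = T.map f ≫ P.a := by
  refine (congrArg Algebra.Hom.f (T.adj.homEquiv_counit X P f)).trans ?_
  rw [adj_counit]
  rfl

omit [T.WeaklyCounital] [T.WeaklyUnital] in
lemma map_tensorHom_proj_a_incl {X Y : C} {P Q : T.Algebra} (f : X ⟶ P.A) (g : Y ⟶ Q.A) :
    (T.map ((f ⊗ₘ g) ≫ Algebra.proj P Q) ≫ (Algebra.box P Q).a) ≫ Algebra.incl P Q =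
      T.δ₂ X Y ≫ ((T.map f ≫ P.a) ⊗ₘ (T.map g ≫ Q.a)) := by
  rw [Category.assoc, Algebra.box_a_incl, ← Functor.map_comp_assoc, Category.assoc,
    Algebra.proj_incl, Functor.map_comp_assoc, Algebra.map_idem_a, reassoc_of% δ₂_nat,
    tensorHom_comp_tensorHom]

/-- The opmonoidal structure induced by the weak bimonad is the given one. Its binary part is the
transpose `T (X ⊗ Y) ⟶ T X □ T Y` of `X ⊗ Y ⟶ T X ⊗ T Y ⟶ T X □ T Y` followed by the inclusion. -/
lemma weakBimonad_binary (X Y : C) : T.weakBimonad.binary X Y = T.δ₂ X Y := by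
  have h0 : T.weakBimonad.binary X Y =
      ((T.adj.homEquiv (X ⊗ Y) (Algebra.box (T.free.obj X) (T.free.obj Y))).symm
        ((T.adj.unit.app X ⊗ₘ T.adj.unit.app Y) ≫
          Algebra.proj (T.free.obj X) (T.free.obj Y))).f ≫
      Algebra.incl (T.free.obj X) (T.free.obj Y) := by
    rw [WeakBimonad.binary, WeakBimonad.opmonoidal]
    rfl
  have h1 (X : C) : T.map (T.adj.unit.app X) ≫ (T.free.obj X).a = 𝟙 (T.obj X) := by
    rw [adj_unit]
    exact T.map_η_μ X
  refine h0.trans ((congrArg (· ≫ _) (T.adj_homEquiv_symm_f _)).trans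
    ((T.map_tensorHom_proj_a_incl _ _).trans ?_))
  exact (congrArg (T.δ₂ X Y ≫ ·) ((congrArg₂ (fun a b => a ⊗ₘ b) (h1 X) (h1 Y)).trans
    (id_tensorHom_id _ _))).trans (comp_id _)

/-- The nullary part is the transpose `T K ⟶ R` of the unit `K ⟶ R`, which is the projection,
followed by the counit. -/
lemma weakBimonad_nullary : T.weakBimonad.nullary = T.δ₀ := by
  have h0 : T.weakBimonad.nullary =
      ((T.adj.homEquiv (𝟙_ C) T.unitAlgebra).symm T.unitUnit).f ≫ T.unitCounit := by
    rw [WeakBimonad.nullary, WeakBimonad.opmonoidal]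
    rfl
  have h1 : T.map T.unitUnit ≫ T.unitAlgebra.a = T.unitProj := by
    rw [unitUnit, Functor.map_comp, Category.assoc]
    exact (congrArg _ T.map_unitProj_a).trans ((reassoc_of% T.map_η_μ) _ _)
  exact h0.trans ((congrArg (· ≫ _) ((T.adj_homEquiv_symm_f _).trans h1)).trans
    T.unitProj_unitCounit)

end CategoryTheory.Monad

/-! ### Calculus in a duoidal category -/

namespace Duoidal

open CategoryTheory Category MonoidalCategory

section TwoMonoidalStructures

variable {M : Type u} [Category.{v} M] [TwoMonoidalStructures M]

lemma circLeft_comp (X : M) {Y Y' Y'' : M} (f : Y ⟶ Y') (g : Y' ⟶ Y'') :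
    X ◁∘ (f ≫ g) = X ◁∘ f ≫ X ◁∘ g :=
  (circ M).whiskerLeft_comp X f g

lemma circRight_comp {Y Y' Y'' : M} (f : Y ⟶ Y') (g : Y' ⟶ Y'') (X : M) :
    (f ≫ g) ▷∘ X = f ▷∘ X ≫ g ▷∘ X :=
  (circ M).comp_whiskerRight f g X

lemma circLeft_id (X Y : M) : X ◁∘ 𝟙 Y = 𝟙 (X ∘ᵈ Y) := (circ M).whiskerLeft_id X Y

lemma circRight_id (X Y : M) : 𝟙 X ▷∘ Y = 𝟙 (X ∘ᵈ Y) := (circ M).id_whiskerRight X Y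

lemma circ_exchange {W X Y Z : M} (f : W ⟶ X) (g : Y ⟶ Z) :
    W ◁∘ g ≫ f ▷∘ Z = f ▷∘ Y ≫ X ◁∘ g :=
  (circ M).whisker_exchange f g

lemma id_circHom (X : M) {Y Z : M} (f : Y ⟶ Z) : 𝟙 X ∘ᵐ f = X ◁∘ f := (circ M).id_tensorHom X f

lemma circHom_id {X Y : M} (f : X ⟶ Y) (Z : M) : f ∘ᵐ 𝟙 Z = f ▷∘ Z := (circ M).tensorHom_id f Z

lemma circHom_def {W X Y Z : M} (f : W ⟶ X) (g : Y ⟶ Z) : f ∘ᵐ g = f ▷∘ Y ≫ X ◁∘ g :=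
  (circ M).tensorHom_def f g

lemma circr_inv_nat {X Y : M} (f : X ⟶ Y) :
    f ≫ (circr Y).inv = (circr X).inv ≫ f ▷∘ I M :=
  @rightUnitor_inv_naturality M _ (circ M) X Y f

lemma circl_nat {X Y : M} (f : X ⟶ Y) : I M ◁∘ f ≫ (circl Y).hom = (circl X).hom ≫ f :=
  (circ M).leftUnitor_naturality f

lemma circα_nat_right (X Y : M) {Z Z' : M} (f : Z ⟶ Z') :
    (X ∘ᵈ Y) ◁∘ f ≫ (circα X Y Z').hom = (circα X Y Z).hom ≫ X ◁∘ (Y ◁∘ f) :=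
  @associator_naturality_right M _ (circ M) X Y Z Z' f

lemma circα_nat_middle (X : M) {Y Y' : M} (f : Y ⟶ Y') (Z : M) :
    (X ◁∘ f) ▷∘ Z ≫ (circα X Y' Z).hom = (circα X Y Z).hom ≫ X ◁∘ (f ▷∘ Z) :=
  @associator_naturality_middle M _ (circ M) X Y Y' f Z

lemma circr_inv_circα (X Y : M) :
    (circr (X ∘ᵈ Y)).inv ≫ (circα X Y (I M)).hom = X ◁∘ (circr Y).inv := by
  rw [← Iso.eq_comp_inv]
  exact @rightUnitor_tensor_inv M _ (circ M) X Y

lemma circα_circl (X Y : M) :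
    (circα X (I M) Y).hom ≫ X ◁∘ (circl Y).hom = (circr X).hom ▷∘ Y :=
  (circ M).triangle X Y

lemma bullLeft_comp (X : M) {Y Y' Y'' : M} (f : Y ⟶ Y') (g : Y' ⟶ Y'') :
    X ◁• (f ≫ g) = X ◁• f ≫ X ◁• g :=
  (bull M).whiskerLeft_comp X f g

lemma bullRight_comp {Y Y' Y'' : M} (f : Y ⟶ Y') (g : Y' ⟶ Y'') (X : M) :
    (f ≫ g) ▷• X = f ▷• X ≫ g ▷• X :=
  (bull M).comp_whiskerRight f g X

lemma bull_exchange {W X Y Z : M} (f : W ⟶ X) (g : Y ⟶ Z) :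
    W ◁• g ≫ f ▷• Z = f ▷• Y ≫ X ◁• g :=
  (bull M).whisker_exchange f g

lemma id_bullHom (X : M) {Y Z : M} (f : Y ⟶ Z) : 𝟙 X •ᵐ f = X ◁• f := (bull M).id_tensorHom X f

lemma bullHom_id {X Y : M} (f : X ⟶ Y) (Z : M) : f •ᵐ 𝟙 Z = f ▷• Z := (bull M).tensorHom_id f Z

lemma id_bullHom_id (X Y : M) : 𝟙 X •ᵐ 𝟙 Y = 𝟙 (X •ᵈ Y) := (bull M).id_tensorHom_id X Y

lemma bullRight_bullLeft {W X Y Z : M} (f : W ⟶ X) (g : Y ⟶ Z) :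
    f ▷• Y ≫ X ◁• g = f •ᵐ g :=
  ((bull M).tensorHom_def f g).symm

lemma bullLeft_bullRight {W X Y Z : M} (f : W ⟶ X) (g : Y ⟶ Z) :
    W ◁• g ≫ f ▷• Z = f •ᵐ g :=
  (bull_exchange f g).trans (bullRight_bullLeft f g)

lemma bullHom_comp {X X' X'' Y Y' Y'' : M} (f : X ⟶ X') (g : Y ⟶ Y') (f' : X' ⟶ X'')
    (g' : Y' ⟶ Y'') : (f •ᵐ g) ≫ (f' •ᵐ g') = (f ≫ f') •ᵐ (g ≫ g') :=
  (bull M).tensorHom_comp_tensorHom f g f' g'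

lemma bullα_inv_nat_left {X X' : M} (f : X ⟶ X') (Y Z : M) :
    f ▷• (Y •ᵈ Z) ≫ (bullα X' Y Z).inv = (bullα X Y Z).inv ≫ (f ▷• Y) ▷• Z :=
  @associator_inv_naturality_left M _ (bull M) X X' f Y Z

lemma bullα_nat_right (X Y : M) {Z Z' : M} (f : Z ⟶ Z') :
    (X •ᵈ Y) ◁• f ≫ (bullα X Y Z').hom = (bullα X Y Z).hom ≫ X ◁• (Y ◁• f) :=
  @associator_naturality_right M _ (bull M) X Y Z Z' f

lemma bulll_nat {X Y : M} (f : X ⟶ Y) : J M ◁• f ≫ (bulll Y).hom = (bulll X).hom ≫ f :=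
  (bull M).leftUnitor_naturality f

lemma bullr_nat {X Y : M} (f : X ⟶ Y) : f ▷• J M ≫ (bullr Y).hom = (bullr X).hom ≫ f :=
  (bull M).rightUnitor_naturality f

lemma bullα_inv_bulll (X Y : M) :
    (bullα (J M) X Y).inv ≫ (bulll X).hom ▷• Y = (bulll (X •ᵈ Y)).hom := by
  exact (@leftUnitor_tensor_hom M _ (bull M) X Y).symm

lemma bullα_bullr (X Y : M) :
    (bullα X Y (J M)).hom ≫ X ◁• (bullr Y).hom = (bullr (X •ᵈ Y)).hom := by
  exact (@rightUnitor_tensor_hom M _ (bull M) X Y).symm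

end TwoMonoidalStructures

variable {M : Type u} [Category.{v} M] [DuoidalCategory M]

lemma ζ_nat_left {A A' B B' : M} (a : A ⟶ A') (b : B ⟶ B') (C D : M) :
    (a •ᵐ b) ▷∘ (C •ᵈ D) ≫ ζ A' B' C D = ζ A B C D ≫ ((a ▷∘ C) •ᵐ (b ▷∘ D)) := by
  have h := ζ_natural a b (𝟙 C) (𝟙 D)
  rwa [id_bullHom_id, circHom_id, circHom_id, circHom_id] at h

lemma ζ_nat_right (A B : M) {C C' D D' : M} (c : C ⟶ C') (d : D ⟶ D') :
    (A •ᵈ B) ◁∘ (c •ᵐ d) ≫ ζ A B C' D' = ζ A B C D ≫ ((A ◁∘ c) •ᵐ (B ◁∘ d)) := by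
  have h := ζ_natural (𝟙 A) (𝟙 B) c d
  rwa [id_bullHom_id, id_circHom, id_circHom, id_circHom] at h

/-- The morphism `X • Y ⟶ (X ∘ B) • (Y ∘ C)` which inserts a morphism `I ⟶ B • C` and applies the
interchange law. -/
def act {B C : M} (f : I M ⟶ B •ᵈ C) (X Y : M) : X •ᵈ Y ⟶ (X ∘ᵈ B) •ᵈ (Y ∘ᵈ C) :=
  (circr (X •ᵈ Y)).inv ≫ ((X •ᵈ Y) ◁∘ f) ≫ ζ X Y B C

lemma act_comp {B B' C C' : M} (f : I M ⟶ B •ᵈ C) (b : B ⟶ B') (c : C ⟶ C') (X Y : M) :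
    act (f ≫ (b •ᵐ c)) X Y = act f X Y ≫ ((X ◁∘ b) •ᵐ (Y ◁∘ c)) := by
  rw [act, act, reassoc_of% circLeft_comp, ζ_nat_right, Category.assoc, Category.assoc]

lemma act_nat {B C X X' Y Y' : M} (f : I M ⟶ B •ᵈ C) (x : X ⟶ X') (y : Y ⟶ Y') :
    (x •ᵐ y) ≫ act f X' Y' = act f X Y ≫ ((x ▷∘ B) •ᵐ (y ▷∘ C)) := by
  rw [act, act, reassoc_of% circr_inv_nat, ← reassoc_of% circ_exchange, ζ_nat_left, Category.assoc,
    Category.assoc]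

/-- Inserting `δ : I ⟶ I • I` does nothing, up to the unitors. -/
lemma act_δ (X Y : M) : act δ X Y = (circr X).inv •ᵐ (circr Y).inv := by
  have h := δ_unit_right X Y
  have h' : ((circr X).hom •ᵐ (circr Y).hom) ≫ ((circr X).inv •ᵐ (circr Y).inv) = 𝟙 _ := by
    rw [bullHom_comp, Iso.hom_inv_id, Iso.hom_inv_id, id_bullHom_id]
  rw [act, Iso.inv_comp_eq, ← h, Category.assoc, Category.assoc, h', comp_id]

/-- Inserting `f : I ⟶ B • C` in the last two factors of `X • Y • Z` amounts to inserting a morphism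
`I ⟶ (I • B) • C` in all three factors, by the associativity of `ζ` with respect to `•`. -/
lemma bullLeft_act {B C : M} (f : I M ⟶ B •ᵈ C) (X Y Z : M) :
    (bullα X Y Z).hom ≫ X ◁• act f Y Z ≫ (bullα _ _ _).inv =
      act (δ ≫ I M ◁• f ≫ (bullα (I M) B C).inv) (X •ᵈ Y) Z ≫
        (ζ X Y (I M) B ≫ (circr X).hom ▷• (Y ∘ᵈ B)) ▷• (Z ∘ᵈ C) := by
  have h1 : X ◁• act f Y Z = act (δ ≫ I M ◁• f) X (Y •ᵈ Z) ≫
      (X ∘ᵈ I M) ◁• ζ Y Z B C ≫ (circr X).hom ▷• _ := by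
    rw [← id_bullHom (I M), act_comp, act_δ, circLeft_id, ← id_bullHom, ← id_bullHom,
      ← bullHom_id]
    simp only [act, bullHom_comp, Category.assoc, comp_id, id_comp, Iso.inv_hom_id]
  have h2 := ζ_assoc_bull X Y Z (I M) B C
  rw [← Category.assoc, ← Iso.eq_comp_inv, circHom_def, ← circ_exchange] at h2
  simp only [Category.assoc] at h2
  rw [h1, bullRight_comp, act, act]
  simp only [Category.assoc]
  rw [reassoc_of% h2, ← bullα_inv_nat_left, reassoc_of% circr_inv_nat, ← reassoc_of% circ_exchange,
    ← reassoc_of% circLeft_comp]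
  simp only [Category.assoc, Iso.inv_hom_id, comp_id]

/-- Inserting `f : I ⟶ B • C` in the first two factors of `X • Y • Z` amounts to inserting a
morphism `I ⟶ B • (C • I)` in all three factors. -/
lemma bullRight_act {B C : M} (f : I M ⟶ B •ᵈ C) (X Y Z : M) :
    (bullα X Y Z).inv ≫ act f X Y ▷• Z ≫ (bullα _ _ _).hom =
      act (δ ≫ f ▷• I M ≫ (bullα B C (I M)).hom) X (Y •ᵈ Z) ≫
        (X ∘ᵈ B) ◁• (ζ Y Z C (I M) ≫ (Y ∘ᵈ C) ◁• (circr Z).hom) := by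
  have h1 : act f X Y ▷• Z = act (δ ≫ f ▷• I M) (X •ᵈ Y) Z ≫
      ζ X Y B C ▷• (Z ∘ᵈ I M) ≫ _ ◁• (circr Z).hom := by
    rw [← bullHom_id f (I M), act_comp, act_δ, circLeft_id, ← bullHom_id, ← bullHom_id,
      ← id_bullHom]
    simp only [act, bullHom_comp, Category.assoc, comp_id, id_comp, Iso.inv_hom_id]
  have h2 := ζ_assoc_bull X Y Z B C (I M)
  rw [circHom_def, ← circ_exchange, Category.assoc] at h2
  rw [h1, bullLeft_comp, act, act]
  simp only [Category.assoc]
  rw [bullα_nat_right, reassoc_of% h2, ← reassoc_of% circLeft_comp, reassoc_of% circ_exchange,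
    ← reassoc_of% circr_inv_nat, Iso.inv_hom_id_assoc, Category.assoc]

/-- Inserting `f : I ⟶ B • C` in the second argument of `ζ X Y` amounts to inserting `f` after
`ζ X Y`: this is the associativity of `ζ` with respect to `∘`. -/
lemma circLeft_act_ζ {B C A E : M} (f : I M ⟶ B •ᵈ C) (m : A ∘ᵈ C ⟶ E) (X Y : M) :
    (X •ᵈ Y) ◁∘ (act f (I M) A ≫ ((circl B).hom •ᵐ m)) ≫ ζ X Y B E =
      ζ X Y (I M) A ≫ (circr X).hom ▷• (Y ∘ᵈ A) ≫ act f X (Y ∘ᵈ A) ≫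
        (X ∘ᵈ B) ◁• ((circα Y A C).hom ≫ Y ◁∘ m) := by
  have h := ζ_assoc_circ X Y (I M) A B C
  rw [reassoc_of% circLeft_comp, ζ_nat_right, ← bullHom_id, ← id_bullHom, reassoc_of% act_nat,
    bullHom_comp, comp_id, circRight_id, id_comp]
  simp only [act, circLeft_comp, Category.assoc]
  rw [← reassoc_of% circr_inv_circα, ← reassoc_of% circα_nat_right, ← reassoc_of% h,
    reassoc_of% circ_exchange, ← reassoc_of% circr_inv_nat, bullHom_comp, circα_circl]

lemma circLeft_act_ζ' {B C A E : M} (f : I M ⟶ B •ᵈ C) (m : A ∘ᵈ B ⟶ E) (X Y : M) :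
    (X •ᵈ Y) ◁∘ (act f A (I M) ≫ (m •ᵐ (circl C).hom)) ≫ ζ X Y E C =
      ζ X Y A (I M) ≫ (X ∘ᵈ A) ◁• (circr Y).hom ≫ act f (X ∘ᵈ A) Y ≫
        ((circα X A B).hom ≫ X ◁∘ m) ▷• (Y ∘ᵈ C) := by
  have h := ζ_assoc_circ X Y A (I M) B C
  rw [reassoc_of% circLeft_comp, ζ_nat_right, ← bullHom_id, ← id_bullHom, reassoc_of% act_nat,
    bullHom_comp, comp_id, circRight_id, id_comp]
  simp only [act, circLeft_comp, Category.assoc]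
  rw [← reassoc_of% circr_inv_circα, ← reassoc_of% circα_nat_right, ← reassoc_of% h,
    reassoc_of% circ_exchange, ← reassoc_of% circr_inv_nat, bullHom_comp, circα_circl]

/-- The morphism `I • A ⟶ A` which deletes `I` by means of `τ`. -/
abbrev dropLeft (A : M) : I M •ᵈ A ⟶ A := τ ▷• A ≫ (bulll A).hom

/-- The morphism `A • I ⟶ A` which deletes `I` by means of `τ`. -/
abbrev dropRight (A : M) : A •ᵈ I M ⟶ A := A ◁• τ ≫ (bullr A).hom

lemma α_inv_dropLeft (A Q : M) :
    (bullα (I M) A Q).inv ≫ dropLeft A ▷• Q = dropLeft (A •ᵈ Q) := by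
  rw [dropLeft, dropLeft, bullRight_comp, ← reassoc_of% bullα_inv_nat_left, bullα_inv_bulll]

lemma α_dropRight (Q A : M) :
    (bullα Q A (I M)).hom ≫ Q ◁• dropRight A = dropRight (Q •ᵈ A) := by
  rw [dropRight, dropRight, bullLeft_comp, ← reassoc_of% bullα_nat_right, bullα_bullr]

lemma δ_dropLeft {Q : M} (f : I M ⟶ Q) : δ ≫ I M ◁• f ≫ dropLeft Q = f := by
  rw [dropLeft, reassoc_of% bull_exchange, reassoc_of% (δ_τ_left (M := M)), bulll_nat,
    Iso.inv_hom_id_assoc]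

lemma δ_dropRight {Q : M} (f : I M ⟶ Q) : δ ≫ f ▷• I M ≫ dropRight Q = f := by
  rw [dropRight, ← reassoc_of% bull_exchange, reassoc_of% (δ_τ_right (M := M)), bullr_nat,
    Iso.inv_hom_id_assoc]

end Duoidal

/-! ### The monad of a right weak bimonoid -/

namespace RightWeakBimonoid

open CategoryTheory Category MonoidalCategory MonoidComonoid

variable {M : Type u} [Category.{v} M] [DuoidalCategory M] (A : M) [MonoidComonoid A]

lemma comul_assoc : Δ A ≫ Δ A ▷• A ≫ (bullα A A A).hom = Δ A ≫ A ◁• Δ A :=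
  (@ComonObj.comul_assoc M _ (bull M) A comon).symm

lemma counit_comul : Δ A ≫ ε A ▷• A = (bulll A).inv :=
  @ComonObj.counit_comul M _ (bull M) A comon

lemma comul_counit : Δ A ≫ A ◁• ε A = (bullr A).inv :=
  @ComonObj.comul_counit M _ (bull M) A comon

/-- The binary part `(X • Y) ∘ A ⟶ (X ∘ A) • (Y ∘ A)` of the opmonoidal structure. -/
abbrev binary (X Y : M) : (X •ᵈ Y) ∘ᵈ A ⟶ (X ∘ᵈ A) •ᵈ (Y ∘ᵈ A) :=
  ((X •ᵈ Y) ◁∘ Δ A) ≫ ζ X Y A A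

/-- The nullary part `J ∘ A ⟶ J` of the opmonoidal structure. -/
abbrev nullary : J M ∘ᵈ A ⟶ J M := (J M ◁∘ ε A) ≫ ϖ

lemma binary_nat_left {X Y : M} (f : X ⟶ Y) (Z : M) :
    binary A X Z ≫ (f ▷∘ A) ▷• (Z ∘ᵈ A) = (f ▷• Z) ▷∘ A ≫ binary A Y Z := by
  rw [binary, binary, ← bullHom_id f, ← reassoc_of% circ_exchange, ζ_nat_left, circRight_id,
    bullHom_id, Category.assoc]

lemma binary_nat_right (Z : M) {X Y : M} (f : X ⟶ Y) :
    binary A Z X ≫ (Z ∘ᵈ A) ◁• (f ▷∘ A) = (Z ◁• f) ▷∘ A ≫ binary A Z Y := by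
  rw [binary, binary, ← id_bullHom Z f, ← reassoc_of% circ_exchange, ζ_nat_left, circRight_id,
    id_bullHom, Category.assoc]

lemma binary_assoc (X Y Z : M) :
    binary A (X •ᵈ Y) Z ≫ binary A X Y ▷• (Z ∘ᵈ A) ≫ (bullα _ _ _).hom =
      (bullα X Y Z).hom ▷∘ A ≫ binary A X (Y •ᵈ Z) ≫ (X ∘ᵈ A) ◁• binary A Y Z := by
  have h1 : ζ (X •ᵈ Y) Z A A ≫ ((X •ᵈ Y) ◁∘ Δ A) ▷• (Z ∘ᵈ A) =
      ((X •ᵈ Y) •ᵈ Z) ◁∘ (Δ A ▷• A) ≫ ζ (X •ᵈ Y) Z (A •ᵈ A) A := by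
    rw [← bullHom_id, ← bullHom_id, ζ_nat_right, circLeft_id]
  have h2 : ζ X (Y •ᵈ Z) A A ≫ (X ∘ᵈ A) ◁• ((Y •ᵈ Z) ◁∘ Δ A) =
      (X •ᵈ (Y •ᵈ Z)) ◁∘ (A ◁• Δ A) ≫ ζ X (Y •ᵈ Z) A (A •ᵈ A) := by
    rw [← id_bullHom, ← id_bullHom, ζ_nat_right, circLeft_id]
  simp only [binary, bullRight_comp, bullLeft_comp, Category.assoc]
  rw [reassoc_of% h1, reassoc_of% h2, ζ_assoc_bull, circHom_def, ← circ_exchange, Category.assoc,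
    ← reassoc_of% circLeft_comp, ← reassoc_of% circLeft_comp, Category.assoc, comul_assoc,
    reassoc_of% circ_exchange, reassoc_of% circLeft_comp]

lemma binary_nullary_left (X : M) :
    (bulll X).inv ▷∘ A ≫ binary A (J M) X ≫ nullary A ▷• (X ∘ᵈ A) = (bulll (X ∘ᵈ A)).inv := by
  have h1 : ζ (J M) X A A ≫ (J M ◁∘ ε A) ▷• (X ∘ᵈ A) =
      (J M •ᵈ X) ◁∘ (ε A ▷• A) ≫ ζ (J M) X (J M) A := by
    rw [← bullHom_id, ← bullHom_id, ζ_nat_right, circLeft_id]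
  have h2 := ϖ_unit_left X A
  rw [← Category.assoc, ← Iso.eq_comp_inv] at h2
  simp only [binary, nullary, bullRight_comp, Category.assoc]
  rw [reassoc_of% h1, h2, ← reassoc_of% circLeft_comp, counit_comul, circHom_def, ← circ_exchange,
    Category.assoc, ← reassoc_of% circLeft_comp, Iso.inv_hom_id, circLeft_id, id_comp,
    ← reassoc_of% circRight_comp, Iso.inv_hom_id, circRight_id, id_comp]

lemma binary_nullary_right (X : M) :
    (bullr X).inv ▷∘ A ≫ binary A X (J M) ≫ (X ∘ᵈ A) ◁• nullary A = (bullr (X ∘ᵈ A)).inv := by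
  have h1 : ζ X (J M) A A ≫ (X ∘ᵈ A) ◁• (J M ◁∘ ε A) =
      (X •ᵈ J M) ◁∘ (A ◁• ε A) ≫ ζ X (J M) A (J M) := by
    rw [← id_bullHom, ← id_bullHom, ζ_nat_right, circLeft_id]
  have h2 := ϖ_unit_right X A
  rw [← Category.assoc, ← Iso.eq_comp_inv] at h2
  simp only [binary, nullary, bullLeft_comp, Category.assoc]
  rw [reassoc_of% h1, h2, ← reassoc_of% circLeft_comp, comul_counit, circHom_def, ← circ_exchange,
    Category.assoc, ← reassoc_of% circLeft_comp, Iso.inv_hom_id, circLeft_id, id_comp,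
    ← reassoc_of% circRight_comp, Iso.inv_hom_id, circRight_id, id_comp]

/-- The multiplication of the monad `(-) ∘ A`. -/
abbrev mul (X : M) : (X ∘ᵈ A) ∘ᵈ A ⟶ X ∘ᵈ A := (circα X A A).hom ≫ X ◁∘ μ A

variable [RightWeakBimonoid A]

lemma mul_binary (X Y : M) : mul A (X •ᵈ Y) ≫ binary A X Y =
    binary A X Y ▷∘ A ≫ binary A (X ∘ᵈ A) (Y ∘ᵈ A) ≫ (mul A X •ᵐ mul A Y) := by
  have h := ζ_assoc_circ X Y A A A A
  simp only [mul, binary, Category.assoc, circRight_comp]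
  rw [← reassoc_of% circLeft_comp, mul_comul, ← bullHom_comp, circHom_def]
  simp only [circLeft_comp, Category.assoc]
  rw [ζ_nat_right, ← reassoc_of% circα_nat_middle, ← reassoc_of% circα_nat_right, ← reassoc_of% h,
    reassoc_of% circ_exchange]

/-- The composite `I ⟶ A ⟶ A • A` of the unit and the comultiplication. -/
abbrev unitComul : I M ⟶ A •ᵈ A := η A ≫ Δ A

/-- The axiom `rru` with the redundant factor `I` removed, as an equality of morphisms
`I ⟶ (A • A) • A`. -/
lemma unitComul_right :
    δ ≫ I M ◁• unitComul A ≫ (bullα (I M) A A).inv ≫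
        (act (unitComul A) (I M) A ≫ ((circl A).hom •ᵐ μ A)) ▷• A =
      η A ≫ Δ A ≫ Δ A ▷• A := by
  have h := congrArg (· ≫ (dropLeft A ▷• A) ▷• A) (rru (A := A))
  have hα : Δ A ≫ A ◁• Δ A ≫ (bullα A A A).inv = Δ A ≫ Δ A ▷• A := by
    rw [← reassoc_of% comul_assoc, Iso.hom_inv_id, comp_id]
  have hζ : ζ (I M) A (I M •ᵈ A) A ≫ (I M ◁∘ dropLeft A) ▷• (A ∘ᵈ A) =
      (I M •ᵈ A) ◁∘ (dropLeft A ▷• A) ≫ ζ (I M) A A A := by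
    rw [← bullHom_id, ← bullHom_id, ζ_nat_right, circLeft_id]
  simp only [Category.assoc, ← bullRight_comp] at h
  rw [bull_exchange, ← reassoc_of% bullRight_comp, ← circl_nat, reassoc_of% bullRight_comp,
    reassoc_of% hζ, ← reassoc_of% circLeft_comp, ← reassoc_of% circLeft_comp,
    ← reassoc_of% circLeft_comp] at h
  simp only [Category.assoc] at h
  rw [α_inv_dropLeft, δ_dropLeft, ← bullα_inv_nat_left, reassoc_of% bull_exchange,
    reassoc_of% α_inv_dropLeft] at h
  have hη : δ ≫ I M ◁• (η A ≫ Δ A) ≫ τ ▷• (A •ᵈ A) ≫ (bulll (A •ᵈ A)).hom = η A ≫ Δ A :=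
    δ_dropLeft _
  rw [← reassoc_of% bullLeft_comp, reassoc_of% hη, hα, bullRight_bullLeft] at h
  simp only [act, Category.assoc]
  exact h

/-- The axiom `lru` with the redundant factor `I` removed, as an equality of morphisms
`I ⟶ A • (A • A)`. -/
lemma unitComul_left :
    δ ≫ unitComul A ▷• I M ≫ (bullα A A (I M)).hom ≫
        A ◁• (act (unitComul A) A (I M) ≫ (μ A •ᵐ (circl A).hom)) =
      η A ≫ Δ A ≫ A ◁• Δ A := by
  have h := congrArg (· ≫ A ◁• A ◁• dropRight A) (lru (A := A))
  have hα : Δ A ≫ Δ A ▷• A ≫ (bullα A A A).hom = Δ A ≫ A ◁• Δ A := comul_assoc A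
  have hζ : ζ A (I M) A (A •ᵈ I M) ≫ (A ∘ᵈ A) ◁• (I M ◁∘ dropRight A) =
      (A •ᵈ I M) ◁∘ (A ◁• dropRight A) ≫ ζ A (I M) A A := by
    rw [← id_bullHom, ← id_bullHom, ζ_nat_right, circLeft_id]
  simp only [Category.assoc, ← bullLeft_comp] at h
  rw [← bull_exchange, ← reassoc_of% bullLeft_comp, ← circl_nat, reassoc_of% bullLeft_comp,
    reassoc_of% hζ, ← reassoc_of% circLeft_comp, ← reassoc_of% circLeft_comp,
    ← reassoc_of% circLeft_comp] at h
  simp only [Category.assoc] at h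
  rw [α_dropRight, δ_dropRight, ← bullα_nat_right, ← reassoc_of% bull_exchange,
    reassoc_of% α_dropRight] at h
  have hη : δ ≫ (η A ≫ Δ A) ▷• I M ≫ (A •ᵈ A) ◁• τ ≫ (bullr (A •ᵈ A)).hom = η A ≫ Δ A :=
    δ_dropRight _
  rw [← reassoc_of% bullRight_comp, reassoc_of% hη, hα, bullLeft_bullRight] at h
  simp only [act, Category.assoc]
  exact h

/-- The monad `(-) ∘ A` is weakly unital: the equality `unitComul_right` of morphisms
`I ⟶ (A • A) • A` is inserted in the three factors of `X • Y • Z`. -/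
lemma act_right (X Y Z : M) :
    (bullα X Y Z).hom ≫ X ◁• act (unitComul A) Y Z ≫ (bullα _ _ _).inv ≫
      act (unitComul A) X (Y ∘ᵈ A) ▷• (Z ∘ᵈ A) ≫ ((X ∘ᵈ A) ◁• mul A Y) ▷• (Z ∘ᵈ A) =
      act (unitComul A) (X •ᵈ Y) Z ≫ binary A X Y ▷• (Z ∘ᵈ A) := by
  rw [reassoc_of% bullLeft_act, ← bullRight_comp, ← bullRight_comp, Category.assoc,
    ← circLeft_act_ζ, bullRight_comp]
  have h : (((X •ᵈ Y) ◁∘ (act (unitComul A) (I M) A ≫ ((circl A).hom •ᵐ μ A))) ▷• (Z ∘ᵈ A)) =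
      ((X •ᵈ Y) ◁∘ (act (unitComul A) (I M) A ≫ ((circl A).hom •ᵐ μ A))) •ᵐ (Z ◁∘ 𝟙 A) := by
    rw [circLeft_id, bullHom_id]
  rw [h, ← reassoc_of% act_comp, bullHom_id]
  simp only [Category.assoc]
  rw [unitComul_right, ← bullHom_id, ← Category.assoc, act_comp, circLeft_id, bullHom_id,
    bullRight_comp, Category.assoc]

/-- The mirror image of `act_right`, from `unitComul_left`. -/
lemma act_left (X Y Z : M) :
    (bullα X Y Z).inv ≫ act (unitComul A) X Y ▷• Z ≫ (bullα _ _ _).hom ≫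
      (X ∘ᵈ A) ◁• act (unitComul A) (Y ∘ᵈ A) Z ≫ (X ∘ᵈ A) ◁• (mul A Y ▷• (Z ∘ᵈ A)) =
      act (unitComul A) X (Y •ᵈ Z) ≫ (X ∘ᵈ A) ◁• binary A Y Z := by
  rw [reassoc_of% bullRight_act, ← bullLeft_comp, ← bullLeft_comp, Category.assoc,
    ← circLeft_act_ζ', bullLeft_comp]
  have h : ((X ∘ᵈ A) ◁• ((Y •ᵈ Z) ◁∘ (act (unitComul A) A (I M) ≫ (μ A •ᵐ (circl A).hom)))) =
      (X ◁∘ 𝟙 A) •ᵐ ((Y •ᵈ Z) ◁∘ (act (unitComul A) A (I M) ≫ (μ A •ᵐ (circl A).hom))) := by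
    rw [circLeft_id, id_bullHom]
  rw [h, ← reassoc_of% act_comp, id_bullHom]
  simp only [Category.assoc]
  rw [unitComul_left, ← id_bullHom, ← Category.assoc, act_comp, circLeft_id, id_bullHom,
    bullLeft_comp, Category.assoc]

end RightWeakBimonoid

namespace RightWeakBimonoid

open CategoryTheory Category MonoidComonoid

attribute [local instance] Duoidal.bull

variable {M : Type u} [Category.{v} M] [DuoidalCategory M] (A : M) [MonoidComonoid A]

/-- The opmonoidal structure of the functor `(-) ∘ A`. -/
instance : (circMonad A).toFunctor.OplaxMonoidal where
  η := nullary A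
  δ := binary A
  δ_natural_left f Z := binary_nat_left A f Z
  δ_natural_right Z f := binary_nat_right A Z f
  oplax_associativity X Y Z := binary_assoc A X Y Z
  oplax_left_unitality X := (binary_nullary_left A X).symm
  oplax_right_unitality X := (binary_nullary_right A X).symm

lemma unit₂_eq (X Y : M) : (circMonad A).unit₂ X Y = act (unitComul A) X Y := by
  have h : (circMonad A).unit₂ X Y =
      ((circr (X •ᵈ Y)).inv ≫ (X •ᵈ Y) ◁∘ η A) ≫ (X •ᵈ Y) ◁∘ Δ A ≫ ζ X Y A A := rfl
  rw [h, act, circLeft_comp, Category.assoc, Category.assoc]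

lemma mul_nullary : mul A (J M) ≫ nullary A = counitMul A := by
  rw [mul, nullary, counitMul, circLeft_comp, Category.assoc, Category.assoc]

lemma mul_counitMul : mul A (J M ∘ᵈ A) ≫ counitMul A = counitMulMul A := by
  rw [mul, counitMul, counitMulMul, circLeft_comp]
  simp only [Category.assoc]

variable [RightWeakBimonoid A]

lemma counit_left :
    ((bullr (J M ∘ᵈ A)).inv ▷∘ A ≫ binary A (J M ∘ᵈ A) (J M) ≫
      (mul A (J M) ≫ nullary A) ▷• (J M ∘ᵈ A) ≫ (bulll (J M ∘ᵈ A)).hom) ▷∘ A ≫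
        mul A (J M) ≫ nullary A =
      mul A (J M ∘ᵈ A) ≫ mul A (J M) ≫ nullary A := by
  rw [mul_nullary, mul_counitMul, ← lrc, binary, Category.assoc, ← reassoc_of% circ_exchange]

lemma counit_right :
    ((bulll (J M ∘ᵈ A)).inv ▷∘ A ≫ binary A (J M) (J M ∘ᵈ A) ≫
      (J M ∘ᵈ A) ◁• (mul A (J M) ≫ nullary A) ≫ (bullr (J M ∘ᵈ A)).hom) ▷∘ A ≫
        mul A (J M) ≫ nullary A =
      mul A (J M ∘ᵈ A) ≫ mul A (J M) ≫ nullary A := by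
  rw [mul_nullary, mul_counitMul, ← llc, binary, Category.assoc, ← reassoc_of% circ_exchange]

instance : (circMonad A).MulOpmonoidal where
  μ_δ₂ X Y := mul_binary A X Y

instance : (circMonad A).WeaklyUnital where
  right X Y Z := by
    simp only [unit₂_eq]
    exact act_right A X Y Z
  left X Y Z := by
    simp only [unit₂_eq]
    exact act_left A X Y Z

instance : (circMonad A).WeaklyCounital where
  left := counit_left A
  right := counit_right A

end RightWeakBimonoid

theorem mainTheorem2 {M : Type u} [Category.{v} M] [DuoidalCategory M] [IsIdempotentComplete M]
    (A : M) [MonoidComonoid A] [RightWeakBimonoid A] :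
    ∃ W : @WeakBimonad M _ (bull M) (circMonad A),
      (∀ X Y : M, @WeakBimonad.binary M _ (bull M) _ W X Y =
        ((X •ᵈ Y) ◁∘ MonoidComonoid.Δ A) ≫ DuoidalCategory.ζ X Y A A) ∧
      @WeakBimonad.nullary M _ (bull M) _ W =
        (J M ◁∘ MonoidComonoid.ε A) ≫ DuoidalCategory.ϖ := by
  let := bull M
  exact ⟨(circMonad A).weakBimonad, (circMonad A).weakBimonad_binary,
    (circMonad A).weakBimonad_nullary⟩
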